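/- Let $T$ be a complete first-order theory in a language $L$, put $|T|=|L|+\aleph_0$, and let $\kappa>2^{|T|}$ be a regular cardinal. Let $\mathcal M\models T$ be a monster model, i.e. $\mathcal M$ is $\mu$-saturated and strongly $\mu$-homogeneous for some cardinal $\mu>\kappa$; all tuples below lie in $\mathcal M$ and all types are computed in $\mathcal M$. A formula $\varphi(x;y)$ in finite tuples of variables has SOP$_1$ if there is a tree of tuples $(a_\eta)_{\eta\in{}^{<\omega}2}$ in a model of $T$ such that (i) for every $\eta\in{}^{\omega}2$ the set $\{\varphi(x;a_{\eta\restriction k}) : k<\omega\}$ is consistent, and (ii) whenever $\xi,\nu\in{}^{<\omega}2$ and $\nu$ extends or equals $\xi^\frown 0$, the set $\{\varphi(x;a_{\xi^\frown 1}),\varphi(x;a_\nu)\}$ is inconsistent. The theory $T$ is NSOP$_1$ if no formula has SOP$_1$. An array $(a_{i,j})_{i<\kappa,\,j<2}$ of tuples is an indiscernible SOP$_1$-array if the sequence of pairs $(a_{i,0}a_{i,1})_{i<\kappa}$ is order indiscernible (over $\emptyset$) and, for all $i<\kappa$, $a_{i,0}$ and $a_{i,1}$ have the same type over $\{a_{l,0},a_{l,1}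 : l<i\}$. Then the following are equivalent. 1. $T$ is NSOP$_1$. 2. For any indiscernible SOP$_1$-array $(a_{i,j})_{i<\kappa,\,j<2}$ of finite tuples and any finite tuple $b$, there are $\beta<\kappa$ and a tuple $b'$ such that (a) $\operatorname{tp}(b,a_{\beta,0})=\operatorname{tp}(b',a_{0,1})$, and (b) $(a_{i,1})_{i<\omega}$ is indiscernible over $b'$. 3. For any indiscernible SOP$_1$-array $(a_{i,j})_{i<\kappa,\,j<2}$ of finite tuples and any finite tuple $b$, there is $\gamma<\kappa$ such that for every $\beta$ with $\gamma<\beta<\kappa$ there is a tuple $b'$ satisfying (a) and (b). -/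

import Mathlib

universe u v w x

open FirstOrder Cardinal

namespace ModelNSOP

section Types

variable {L : FirstOrder.Language.{u, v}} {M : Type w} [L.Structure M] [Nonempty M]

/-- `tp(v / A)`: the complete type of the tuple `v` over the parameter set `A`, computed in `M`.
It is a complete type, in the language with constants for `A`, of the elementary diagram of `A`. -/
noncomputable def tpOver (L : FirstOrder.Language.{u, v}) {M : Type w} [L.Structure M] [Nonempty M]
    (A : Set M) {α : Type x} (v : α → M) :
    ((L[[A]]).completeTheory M).CompleteType α :=
  ((L[[A]]).completeTheory M).typeOf v

/-- `M` is `μ`-saturated: every complete `1`-type over fewer than `μ` parameters is realized. -/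
def IsSaturated (L : FirstOrder.Language.{u, v}) (M : Type w) [L.Structure M] [Nonempty M]
    (μ : Cardinal.{w}) : Prop :=
  ∀ A : Set M, #A < μ → ∀ p : ((L[[A]]).completeTheory M).CompleteType (Fin 1),
    p ∈ ((L[[A]]).completeTheory M).realizedTypes M (Fin 1)

/-- `M` is strongly `μ`-homogeneous: every partial elementary map with a domain of fewer than `μ`
elements extends to an automorphism. -/
def IsStronglyHomogeneous (L : FirstOrder.Language.{u, v}) (M : Type w) [L.Structure M] [Nonempty M]
    (μ : Cardinal.{w}) : Prop :=
  ∀ A : Set M, #A < μ → ∀ f : A → M,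
    (L.completeTheory M).typeOf f = (L.completeTheory M).typeOf (fun a : A => (a : M)) →
      ∃ σ : M ≃[L] M, ∀ a : A, σ a = f a

/-- `M` is a monster model (of its theory) with respect to the cardinal `μ`. -/
structure IsMonster (L : FirstOrder.Language.{u, v}) (M : Type w) [L.Structure M] [Nonempty M]
    (μ : Cardinal.{w}) : Prop where
  saturated : IsSaturated L M μ
  stronglyHomogeneous : IsStronglyHomogeneous L M μ

/-- The sequence of tuples `(c i)`, `i ∈ ι`, is (order) indiscernible over `A`: any two increasing
finite subsequences of the same length have the same type over `A`. -/
def IsIndiscernibleOver (L : FirstOrder.Language.{u, v}) {M : Type w} [L.Structure M] [Nonempty M]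
    (A : Set M) {ι : Type*} [LinearOrder ι] {α : Type*} (c : ι → α → M) : Prop :=
  ∀ (n : ℕ) (i j : Fin n → ι), StrictMono i → StrictMono j →
    tpOver L A (fun p : Fin n × α => c (i p.1) p.2) =
      tpOver L A (fun p : Fin n × α => c (j p.1) p.2)

/-- The set of all the coordinates of the tuples `c j 0` and `c j 1` with `j < i`. -/
def rowsBelow {M : Type w} {ι : Type*} [LinearOrder ι] {α : Type*} (c : ι → Fin 2 → α → M)
    (i : ι) : Set M :=
  {y | ∃ j < i, ∃ (e : Fin 2) (k : α), y = c j e k}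

/-- `(c i j)`, `i ∈ ι`, `j < 2`, is an SOP₁-array indiscernible over `A`. -/
structure IsIndiscernibleSOP₁ArrayOver (L : FirstOrder.Language.{u, v}) {M : Type w} [L.Structure M]
    [Nonempty M] (A : Set M) {ι : Type*} [LinearOrder ι] {α : Type*}
    (c : ι → Fin 2 → α → M) : Prop where
  /-- The sequence of the pairs `c i 0, c i 1` is indiscernible over `A`. -/
  indiscernible :
    IsIndiscernibleOver L A (fun (i : ι) (p : Fin 2 × α) => c i p.1 p.2)
  /-- The tuples `c i 0` and `c i 1` have the same type over `A` and all earlier rows. -/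
  type_eq : ∀ i : ι,
    tpOver L (A ∪ rowsBelow c i) (c i 0) = tpOver L (A ∪ rowsBelow c i) (c i 1)

/-- An indiscernible SOP₁-array is an SOP₁-array indiscernible over the empty set. -/
def IsIndiscernibleSOP₁Array (L : FirstOrder.Language.{u, v}) {M : Type w} [L.Structure M]
    [Nonempty M] {ι : Type*} [LinearOrder ι] {α : Type*} (c : ι → Fin 2 → α → M) : Prop :=
  IsIndiscernibleSOP₁ArrayOver L (∅ : Set M) c

/-- The natural number `n` as an ordinal below the infinite cardinal `κ`. -/
noncomputable def natIndex {κ : Cardinal.{x}} (hκ : ℵ₀ ≤ κ) (n : ℕ) : Set.Iio κ.ord :=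
  ⟨(n : Ordinal.{x}), (Ordinal.natCast_lt_omega0 n).trans_le (Cardinal.omega0_le_ord.2 hκ)⟩

end Types

section SOP

variable {L : FirstOrder.Language.{u, v}} {M : Type w} [L.Structure M]

/-- The set `{φ(x; a i) | i ∈ ι}` of formulas with parameters in `M` is consistent: each finite
part of it is satisfied in `M`, i.e. it is consistent with the elementary diagram of `M`. -/
def Consistent {n m : ℕ} (φ : L.Formula (Fin n ⊕ Fin m)) {ι : Type*}
    (a : ι → Fin m → M) : Prop :=
  ∀ F : Finset ι, ∃ b : Fin n → M, ∀ i ∈ F, φ.Realize (Sum.elim b (a i))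

/-- The restriction of the branch `η ∈ ^ω 2` to the natural number `k`. -/
def branchRestrict (η : ℕ → Fin 2) (k : ℕ) : List (Fin 2) :=
  List.ofFn (fun i : Fin k => η i)

/-- `φ(x; y)` has SOP₁ in `M`, witnessed by a tree of tuples indexed by finite binary strings;
`ξ ++ [0] <+: ν` says that the string `ν` extends (or equals) `ξ⌢0`. -/
def HasSOP₁ (M : Type w) [L.Structure M] {n m : ℕ} (φ : L.Formula (Fin n ⊕ Fin m)) : Prop :=
  ∃ a : List (Fin 2) → Fin m → M,
    (∀ η : ℕ → Fin 2, Consistent φ (fun k : ℕ => a (branchRestrict η k))) ∧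
    (∀ ξ ν : List (Fin 2), ξ ++ [0] <+: ν → ¬ Consistent φ ![a (ξ ++ [1]), a ν])

/-- `T` is NSOP₁: no formula `φ(x; y)` in finite tuples of variables has SOP₁ (in any model of
`T`). Models of size at most `|L| + ℵ₀` are enough, by Löwenheim–Skolem, since a witnessing tree
is countable. -/
def IsNSOP₁ (T : L.Theory) : Prop :=
  ∀ (N : FirstOrder.Language.Theory.ModelType.{u, v, max u v} T) (n m : ℕ) (φ : L.Formula (Fin n ⊕ Fin m)),
    ¬ HasSOP₁ N φ

end SOP

end ModelNSOP

open ModelNSOP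

/-!
Everything is reduced to statements about satisfaction of formulas. Equality of types becomes
agreement on formulas (`typeOf_eq_typeOf_iff`, `tpOver_eq_iff`). Saturation becomes the realization
of limits of tuples along arbitrary filters, in fewer than `μ` variables
(`IsSaturated.exists_realize`); together with Ramsey's theorem this extracts indiscernible sequences
of any small order type (`IsSaturated.exists_indiscernible`). Homogeneity makes small tuples of the
same type conjugate (`IsStronglyHomogeneous.exists_equiv`).

From NSOP₁ to the statement about almost all rows `β` (`IsNSOP₁.exists_forall_gt`): if every formula
of `tp(b, a_{β,0})` is consistent along the column `1`, then compactness and extraction give `b'`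
(`IsMonster.exists_indiscernibleOver`). So each bad row `β` has a formula `φ` with `φ(b, a_{β,0})`
whose instances along the column `1` are `k`-inconsistent. There are fewer than `κ` pairs `(φ, k)`
and `κ` is regular, so one pair works for the rows of an infinite subarray, and such a subarray
gives SOP₁ (`exists_hasSOP₁_of_array`). For this, let `q` be maximal such that `q` instances in the
column `1` are consistent with any number of later instances in the column `0`. The `q` instances are
kept fixed. One more instance in the column `1` is then inconsistent with `N` later instances in the
column `0`, for some `N`, and automorphisms that exchange the columns in a row while fixing the
earlier rows unfold the array into an SOP₁ tree whose nodes consist of blocks of `N + 1` rows.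

From the existence of one row `β` to NSOP₁: an SOP₁ tree yields, by the pigeonhole principle along
the nodes `η ⌢ 0 ⋯ 0 ⌢ 1`, an array whose column `0` is realized by some `b`, whose column `1`
is pairwise inconsistent, and whose entries in a row have the same type over the earlier rows
(`IsSaturated.exists_array_of_hasSOP₁`). After extraction this is an indiscernible SOP₁-array
(`IsMonster.exists_indiscernibleSOP₁Array`), and for it no `b'` as required can exist, as `b'` would
satisfy two instances in the column `1`.
-/

namespace ModelNSOP

open FirstOrder.Language Filter

/-! ### Types, saturation and homogeneity -/

section Saturation

variable {L : FirstOrder.Language.{u, v}} {M : Type w} [L.Structure M]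

theorem realize_restrictFreeVar_iff {α β : Type*} [DecidableEq α] {φ : L.Formula α}
    (f : φ.freeVarFinset → β) {y : α → M} {z : β → M} (h : ∀ a, z (f a) = y a) :
    Formula.Realize (φ.restrictFreeVar f) z ↔ φ.Realize y :=
  BoundedFormula.realize_restrictFreeVar y h

theorem typeOf_eq_typeOf_iff [Nonempty M] {T : L.Theory} [M ⊨ T] {N : Type*} [L.Structure N]
    [Nonempty N] [N ⊨ T] {α : Type*} {v : α → M} {w : α → N} :
    T.typeOf v = T.typeOf w ↔ ∀ φ : L.Formula α, φ.Realize v ↔ φ.Realize w := by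
  constructor
  · intro h φ
    rw [← Theory.CompleteType.formula_mem_typeOf (T := T),
      ← Theory.CompleteType.formula_mem_typeOf (T := T), h]
  · intro h
    refine SetLike.ext fun φ => ?_
    rw [Theory.CompleteType.mem_typeOf, Theory.CompleteType.mem_typeOf, h]

theorem tpOver_eq_iff [Nonempty M] {A : Set M} {α : Type*} {v w : α → M} :
    tpOver L A v = tpOver L A w ↔ ∀ φ : L.Formula (A ⊕ α),
      φ.Realize (Sum.elim (fun a : A => (a : M)) v) ↔
        φ.Realize (Sum.elim (fun a : A => (a : M)) w) := by
  rw [tpOver, tpOver, typeOf_eq_typeOf_iff]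
  constructor
  · intro h φ
    obtain ⟨ψ, hψ⟩ : A.Definable L
        {v : α → M | φ.Realize (Sum.elim (fun a : A => (a : M)) v)} :=
      Set.definable_iff_exists_formula_sum.2 ⟨φ, rfl⟩
    have h1 := h ψ
    have h2 : ∀ z : α → M, φ.Realize (Sum.elim (fun a : A => (a : M)) z) ↔ ψ.Realize z :=
      fun z => Set.ext_iff.1 hψ z
    rw [h2, h2, h1]
  · intro h φ
    obtain ⟨ψ, hψ⟩ := Set.definable_iff_exists_formula_sum.1
      (⟨φ, rfl⟩ : A.Definable L {v : α → M | φ.Realize v})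
    have h2 : ∀ z : α → M, φ.Realize z ↔ ψ.Realize (Sum.elim (fun a : A => (a : M)) z) :=
      fun z => Set.ext_iff.1 hψ z
    rw [h2, h2, h]

/-- The ultrapower by an ultrafilter on the set of `α`-tuples is a model of the complete theory in which
the tuple of the coordinate functions realizes the type given by the ultrafilter. -/
theorem exists_realize_iff_eventually [Nonempty M] {α : Type w} (V : Ultrafilter (α → M)) :
    ∃ (N : Type w) (_ : L.Structure N) (_ : Nonempty N) (e : α → N),
      N ⊨ L.completeTheory M ∧ ∀ φ : L.Formula α,
        φ.Realize e ↔ ∀ᶠ y : α → M in (V : Filter (α → M)), φ.Realize y := by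
  refine ⟨(V : Filter (α → M)).Product fun _ => M, inferInstance, inferInstance,
    fun i => ((fun y : α → M => y i) : (V : Filter (α → M)).Product _), ⟨fun φ hφ => ?_⟩,
    fun φ => Ultraproduct.realize_formula_cast φ _⟩
  rw [Ultraproduct.sentence_realize]
  exact Eventually.of_forall fun _ => hφ

/-- A saturated structure realizes every family of definable subsets of the line that lies in a
proper filter. -/
theorem IsSaturated.exists_forall_definable_mem [Nonempty M] {μ : Cardinal.{w}}
    (hM : IsSaturated L M μ) {A : Set M} (hA : #A < μ) (F : Filter (Fin 1 → M)) [F.NeBot] :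
    ∃ d : Fin 1 → M, ∀ s, A.Definable L s → s ∈ F → d ∈ s := by
  have key : ∃ d : Fin 1 → M, ∀ φ : L[[A]].Formula (Fin 1),
      (∀ᶠ y in F, φ.Realize y) → φ.Realize d := by
    let e0 : Fin 1 ≃ ULift.{w} (Fin 1) := Equiv.ulift.symm
    let V : Ultrafilter (ULift.{w} (Fin 1) → M) := (Ultrafilter.of F).map fun y => y ∘ e0.symm
    obtain ⟨N, _, _, e, _, he⟩ := exists_realize_iff_eventually (L := L[[A]]) V
    obtain ⟨d, hd⟩ := hM A hA (((L[[A]]).completeTheory M).typeOf (e ∘ e0))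
    refine ⟨d, fun φ hφ => (typeOf_eq_typeOf_iff.1 hd φ).2 ?_⟩
    rw [← Formula.realize_relabel, he, Ultrafilter.coe_map, eventually_map]
    have h1 : ∀ᶠ y in (Ultrafilter.of F : Filter (Fin 1 → M)), φ.Realize y :=
      Ultrafilter.of_le F hφ
    exact h1.mono fun y hy => Formula.realize_relabel.2 hy
  obtain ⟨d, hd⟩ := key
  refine ⟨d, ?_⟩
  rintro s ⟨φ, rfl⟩ hs
  exact hd φ hs

/-- One step in realizing the limit type of a filter on tuples: if `v` realizes the part of this
type in the variables `J`, then one more coordinate `i` can be realized over `v`. -/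
theorem IsSaturated.exists_extend [Nonempty M] {μ : Cardinal.{w}} (hM : IsSaturated L M μ)
    {N : Type*} [L.Structure N] {I : Type x} (J : Set I)
    (hJ : Cardinal.lift.{w} #J < Cardinal.lift.{x} μ) (i : I) (F : Filter (I → N)) [F.NeBot]
    (v : J → M)
    (hv : ∀ φ : L.Formula J, (∀ᶠ x in F, φ.Realize fun j : J => x j) → φ.Realize v) :
    ∃ d : M, ∀ φ : L.Formula (J ⊕ Fin 1),
      (∀ᶠ x in F, φ.Realize (Sum.elim (fun j : J => x j) fun _ => x i)) →
        φ.Realize (Sum.elim v fun _ => d) := by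
  let G : Filter (Fin 1 → M) :=
    { sets := {s | ∃ φ : L.Formula (J ⊕ Fin 1),
        (∀ᶠ x in F, φ.Realize (Sum.elim (fun j : J => x j) fun _ => x i)) ∧
          ∀ y : Fin 1 → M, φ.Realize (Sum.elim v y) → y ∈ s}
      univ_sets := ⟨⊤, by simp, by simp⟩
      sets_of_superset := by
        rintro s t ⟨φ, h1, h2⟩ hst
        exact ⟨φ, h1, fun y hy => hst (h2 y hy)⟩
      inter_sets := by
        rintro s t ⟨φ, h1, h2⟩ ⟨ψ, h3, h4⟩
        refine ⟨φ ⊓ ψ, ?_, fun y hy => ?_⟩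
        · filter_upwards [h1, h3] with x hx hx'
          exact Formula.realize_inf.2 ⟨hx, hx'⟩
        · exact ⟨h2 y (Formula.realize_inf.1 hy).1, h4 y (Formula.realize_inf.1 hy).2⟩ }
  have hG : G.NeBot := by
    refine ⟨fun h => ?_⟩
    obtain ⟨φ, h1, h2⟩ : (∅ : Set (Fin 1 → M)) ∈ G := h ▸ mem_bot
    have h3 := hv (φ.iExs (Fin 1)) (by
      filter_upwards [h1] with x hx
      exact Formula.realize_iExs.2 ⟨_, hx⟩)
    obtain ⟨y, hy⟩ := Formula.realize_iExs.1 h3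
    exact h2 y hy
  have hA : #(Set.range v) < μ := by
    have := Cardinal.mk_range_le_lift (f := v)
    rw [← Cardinal.lift_lt.{w, x}]
    exact this.trans_lt hJ
  obtain ⟨d, hd⟩ := hM.exists_forall_definable_mem hA G
  refine ⟨d 0, fun φ hφ => ?_⟩
  have h1 : (fun _ : Fin 1 => d 0) = d := by
    ext k; rw [Subsingleton.elim k 0]
  rw [h1]
  refine hd {y | φ.Realize (Sum.elim v y)} ?_ ⟨φ, hφ, fun y hy => hy⟩
  refine Set.definable_iff_exists_formula_sum.2
    ⟨φ.relabel (Sum.map (fun j => ⟨v j, j, rfl⟩) id), ?_⟩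
  ext y
  rw [Set.mem_ofPred_eq, Set.mem_ofPred_eq, Formula.realize_relabel]
  refine iff_of_eq (congrArg φ.Realize ?_)
  ext (j | j) <;> rfl

/-- A saturated structure `M` realizes every limit of tuples of an elementarily equivalent
structure, in fewer than `μ` variables. -/
theorem IsSaturated.exists_realize [Nonempty M] {μ : Cardinal.{w}} (hM : IsSaturated L M μ)
    {N : Type*} [L.Structure N] (hNM : N ≅[L] M) {I : Type x}
    (hI : Cardinal.lift.{w} #I < Cardinal.lift.{x} μ) (F : Filter (I → N)) [F.NeBot] :
    ∃ v : I → M, ∀ φ : L.Formula I, (∀ᶠ x in F, φ.Realize x) → φ.Realize v := by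
  classical
  let r : LinearOrder I := linearOrderOfSTO WellOrderingRel
  have wf : WellFounded ((· < ·) : I → I → Prop) := WellOrderingRel.isWellOrder.wf
  have hlt (J : Set I) : Cardinal.lift.{w} #J < Cardinal.lift.{x} μ :=
    (Cardinal.lift_le.2 (Cardinal.mk_set_le J)).trans_lt hI
  -- the coordinates are chosen by recursion along a well-order of the variables
  let good (i : I) (v : Set.Iio i → M) (d : M) : Prop :=
    ∀ φ : L.Formula (Set.Iio i ⊕ Fin 1),
      (∀ᶠ x in F, φ.Realize (Sum.elim (fun j : Set.Iio i => x j) fun _ => x i)) →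
        φ.Realize (Sum.elim v fun _ => d)
  let step (i : I) (v : ∀ j, j < i → M) : M :=
    Classical.epsilon fun d => good i (fun j => v j j.2) d
  let v : I → M := wf.fix step
  have hv (i : I) : v i = Classical.epsilon fun d => good i (fun j => v j) d :=
    wf.fix_eq step i
  have collect (K : Set I) (hK : ∀ j ∈ K, ∀ φ : L.Formula (Set.Iic j),
        (∀ᶠ x in F, φ.Realize fun k : Set.Iic j => x k) → φ.Realize fun k : Set.Iic j => v k) :
      ∀ φ : L.Formula K, (∀ᶠ x in F, φ.Realize fun j : K => x j) →
        φ.Realize fun j : K => v j := by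
    intro φ hφ
    rcases φ.freeVarFinset.eq_empty_or_nonempty with h | h
    · let f : φ.freeVarFinset → Empty := fun k => absurd k.2 (by simp [h])
      let ψ : L.Sentence := φ.restrictFreeVar f
      obtain ⟨x, hx⟩ := hφ.exists
      have h1 : N ⊨ ψ := (realize_restrictFreeVar_iff f fun k => isEmptyElim (f k)).2 hx
      exact (realize_restrictFreeVar_iff f fun k => isEmptyElim (f k)).1
        ((hNM.realize_sentence ψ).1 h1)
    · have hmem := φ.freeVarFinset.max'_mem h
      set j := φ.freeVarFinset.max' h with hj
      let f : φ.freeVarFinset → Set.Iic (j : I) := fun k => ⟨k.1, φ.freeVarFinset.le_max' _ k.2⟩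
      have h1 := hK j j.2 (φ.restrictFreeVar f) (by
        filter_upwards [hφ] with x hx
        exact (realize_restrictFreeVar_iff f fun _ => rfl).2 hx)
      exact (realize_restrictFreeVar_iff f fun _ => rfl).1 h1
  have main (i : I) : ∀ φ : L.Formula (Set.Iic i),
      (∀ᶠ x in F, φ.Realize fun k : Set.Iic i => x k) → φ.Realize fun k : Set.Iic i => v k := by
    induction i using wf.induction with
    | _ i ih =>
      have h1 : good i (fun j => v j) (v i) := by
        rw [hv i]
        exact Classical.epsilon_spec
          (hM.exists_extend (Set.Iio i) (hlt _) i F (fun j => v j) (collect _ ih))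
      intro φ hφ
      let g : Set.Iic i → Set.Iio i ⊕ Fin 1 := fun k =>
        if h : k.1 < i then Sum.inl ⟨k, h⟩ else Sum.inr 0
      have hgN (x : I → N) :
          Sum.elim (fun j : Set.Iio i => x j) (fun _ => x i) ∘ g = fun k : Set.Iic i => x k := by
        ext k
        by_cases h : k.1 < i
        · simp [g, h]
        · simp [g, le_antisymm k.2 (not_lt.1 h)]
      have hgM : Sum.elim (fun j : Set.Iio i => v j) (fun _ => v i) ∘ g =
          fun k : Set.Iic i => v k := by
        ext k
        by_cases h : k.1 < i
        · simp [g, h]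
        · simp [g, le_antisymm k.2 (not_lt.1 h)]
      have h2 := h1 (φ.relabel g) (by
        filter_upwards [hφ] with x hx
        rwa [Formula.realize_relabel, hgN])
      rwa [Formula.realize_relabel, hgM] at h2
  refine ⟨v, fun φ hφ => ?_⟩
  have h1 := collect Set.univ (fun j _ => main j) (φ.relabel fun k => ⟨k, trivial⟩)
    (by
      filter_upwards [hφ] with x hx
      exact Formula.realize_relabel.2 hx)
  exact Formula.realize_relabel.1 h1

/-- In a strongly homogeneous structure, small tuples of the same type are conjugate. -/
theorem IsStronglyHomogeneous.exists_equiv [Nonempty M] {μ : Cardinal.{w}}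
    (hM : IsStronglyHomogeneous L M μ) {I : Type x}
    (hI : Cardinal.lift.{w} #I < Cardinal.lift.{x} μ) {v w : I → M}
    (h : ∀ φ : L.Formula I, φ.Realize v ↔ φ.Realize w) :
    ∃ σ : M ≃[L] M, ∀ i, σ (v i) = w i := by
  have hA : #(Set.range v) < μ := by
    rw [← Cardinal.lift_lt.{w, x}]
    exact (Cardinal.mk_range_le_lift (f := v)).trans_lt hI
  let g : Set.range v → I := fun a => a.2.choose
  have hg (a : Set.range v) : v (g a) = a := a.2.choose_spec
  obtain ⟨σ, hσ⟩ := hM (Set.range v) hA (w ∘ g) (typeOf_eq_typeOf_iff.2 fun φ => by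
    rw [← Formula.realize_relabel, ← h, Formula.realize_relabel]
    exact iff_of_eq (congrArg φ.Realize (funext hg)))
  refine ⟨σ, fun i => ?_⟩
  rw [hσ ⟨v i, i, rfl⟩]
  have h1 := h (Term.equal (Term.var (g ⟨v i, i, rfl⟩)) (Term.var i))
  simpa [Formula.realize_equal, hg] using h1

/-- Finite tuples with the same type over a small set are conjugate over this set. -/
theorem IsStronglyHomogeneous.exists_equiv_of_tpOver_eq [Nonempty M] {μ : Cardinal.{w}}
    (hM : IsStronglyHomogeneous L M μ) (hμ : ℵ₀ ≤ μ) {A : Set M} (hA : #A < μ) {m : ℕ}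
    {v w : Fin m → M} (h : tpOver L A v = tpOver L A w) :
    ∃ σ : M ≃[L] M, (∀ a ∈ A, σ a = a) ∧ ∀ i, σ (v i) = w i := by
  have hI : Cardinal.lift.{w} #(A ⊕ Fin m) < Cardinal.lift.{w} μ := by
    rw [Cardinal.lift_lt]
    simp only [mk_sum, lift_uzero, mk_fin, lift_natCast]
    exact add_lt_of_lt hμ hA ((Cardinal.natCast_lt_aleph0).trans_le hμ)
  obtain ⟨σ, hσ⟩ := hM.exists_equiv hI (tpOver_eq_iff.1 h)
  exact ⟨σ, fun a ha => hσ (Sum.inl ⟨a, ha⟩), fun i => hσ (Sum.inr i)⟩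

end Saturation

/-! ### Ramsey's theorem -/

section Ramsey

/-- Ramsey's theorem for two colours: along a subsequence of the natural numbers, the colour of
an increasing `r`-tuple is constant. -/
theorem exists_strictMono_homogeneous (r : ℕ) (P : (Fin r → ℕ) → Prop) :
    ∃ (h : ℕ → ℕ) (c : Prop), StrictMono h ∧
      ∀ i : Fin r → ℕ, StrictMono i → (P (h ∘ i) ↔ c) := by
  induction r with
  | zero =>
    exact ⟨id, P (![] : Fin 0 → ℕ), strictMono_id,
      fun i _ => by rw [Subsingleton.elim (id ∘ i) (![] : Fin 0 → ℕ)]⟩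
  | succ r ih =>
    -- thin out the tail of `g` so that the colour of `(g 0, t)` does not depend on `t`
    have step (g : {g : ℕ → ℕ // StrictMono g}) : ∃ g' : {g : ℕ → ℕ // StrictMono g},
        (∃ k : ℕ → ℕ, StrictMono k ∧ (∀ n, 0 < k n) ∧ g'.1 = g.1 ∘ k) ∧
          ∃ c : Prop, ∀ i : Fin r → ℕ, StrictMono i →
            (P (Fin.cons (g.1 0) (g'.1 ∘ i)) ↔ c) := by
      obtain ⟨h, c, hh, hc⟩ := ih fun t => P (Fin.cons (g.1 0) (fun l => g.1 (t l + 1)))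
      exact ⟨⟨fun n => g.1 (h n + 1), fun a b hab => g.2 (Nat.succ_lt_succ (hh hab))⟩,
        ⟨fun n => h n + 1, fun a b hab => Nat.succ_lt_succ (hh hab), fun n => Nat.succ_pos _, rfl⟩,
        c, hc⟩
    choose next hnext c hc using step
    let g : ℕ → {g : ℕ → ℕ // StrictMono g} := fun n => next^[n] ⟨id, strictMono_id⟩
    have hg (n : ℕ) : g (n + 1) = next (g n) := Function.iterate_succ_apply' _ _ _
    let a : ℕ → ℕ := fun n => (g n).1 0
    have hrange (n d : ℕ) : Set.range (g (n + d)).1 ⊆ Set.range (g n).1 := by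
      induction d with
      | zero => rfl
      | succ d ihd =>
        refine subset_trans ?_ ihd
        rw [← add_assoc, hg]
        obtain ⟨k, -, -, hk⟩ := hnext (g (n + d))
        rw [hk]
        exact Set.range_comp_subset_range _ _
    have ha : StrictMono a := by
      refine strictMono_nat_of_lt_succ fun n => ?_
      obtain ⟨k, -, hk0, hk⟩ := hnext (g n)
      change (g n).1 0 < (g (n + 1)).1 0
      rw [hg, hk]
      exact (g n).2 (hk0 0)
    have hcol (n : ℕ) (i : Fin r → ℕ) (hi : StrictMono i) (hin : ∀ l, n < i l) :
        P (Fin.cons (a n) (a ∘ i)) ↔ c (g n) := by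
      have h1 (l : Fin r) : ∃ k, (next (g n)).1 k = a (i l) := by
        obtain ⟨d, hd⟩ := Nat.exists_eq_add_of_le (Nat.succ_le_of_lt (hin l))
        have := hrange (n + 1) d ⟨0, rfl⟩
        rw [hg] at this
        obtain ⟨k, hk⟩ := this
        exact ⟨k, by rw [hk, ← hd]⟩
      choose k hk using h1
      have hk' : StrictMono k := fun l l' hl => by
        rw [← (next (g n)).2.lt_iff_lt, hk, hk]
        exact ha (hi hl)
      rw [← hc (g n) k hk']
      exact iff_of_eq (congrArg (fun t => P (Fin.cons (a n) t)) (funext fun l => (hk l).symm))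
    obtain ⟨u, c', hu, hc'⟩ : ∃ (u : ℕ → ℕ) (c' : Prop), StrictMono u ∧
        ∀ n, c (g (u n)) ↔ c' := by
      by_cases hfr : ∃ᶠ n in atTop, c (g n)
      · obtain ⟨u, hu, h⟩ := extraction_of_frequently_atTop hfr
        exact ⟨u, True, hu, fun n => iff_true_intro (h n)⟩
      · obtain ⟨u, hu, h⟩ := extraction_of_eventually_atTop (not_frequently.1 hfr)
        exact ⟨u, False, hu, fun n => iff_false_intro (h n)⟩
    refine ⟨a ∘ u, c', ha.comp hu, fun i hi => ?_⟩
    rw [← hc' (i 0), ← hcol (u (i 0)) (u ∘ Fin.tail i)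
      (fun l l' hl => hu (hi (Fin.succ_lt_succ_iff.2 hl))) fun l => hu (hi (Fin.succ_pos l))]
    refine iff_of_eq (congrArg P ?_)
    ext l
    refine Fin.cases ?_ (fun l => ?_) l <;> rfl

/-- Ramsey's theorem for finitely many colourings at once. -/
theorem exists_strictMono_forall_homogeneous {κ : Type*} (r : κ → ℕ)
    (P : ∀ k, (Fin (r k) → ℕ) → Prop) (Δ : Finset κ) :
    ∃ h : ℕ → ℕ, StrictMono h ∧ ∀ k ∈ Δ, ∀ i j : Fin (r k) → ℕ, StrictMono i → StrictMono j →
      (P k (h ∘ i) ↔ P k (h ∘ j)) := by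
  classical
  induction Δ using Finset.induction_on with
  | empty => exact ⟨id, strictMono_id, by simp⟩
  | insert k Δ hk ih =>
    obtain ⟨h, hh, hΔ⟩ := ih
    obtain ⟨h', c, hh', hc⟩ := exists_strictMono_homogeneous (r k) fun t => P k (h ∘ t)
    refine ⟨h ∘ h', hh.comp hh', fun k' hk' i j hi hj => ?_⟩
    rcases Finset.mem_insert.1 hk' with rfl | hk'
    · exact (hc i hi).trans (hc j hj).symm
    · exact hΔ k' hk' (h' ∘ i) (h' ∘ j) (hh'.comp hi) (hh'.comp hj)

end Ramsey

/-! ### Extraction of indiscernible sequences -/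

section Indiscernible

variable {L : FirstOrder.Language.{u, v}} {M : Type w} [L.Structure M]

/-- The tuple obtained by concatenating the rows `c (i 0), c (i 1), …` of an array. -/
def rowTuple {M J α : Type*} (c : J → α → M) {r : ℕ} (i : Fin r → J) : Fin r × α → M :=
  fun p => c (i p.1) p.2

/-- Extraction of indiscernibles: in a saturated structure, every sequence of tuples gives rise to
a sequence of any small order type `J` that is indiscernible over a tuple `b'` and satisfies
with `b'` all the formulas that hold of `b` and of every increasing tuple of the given sequence. -/
theorem IsSaturated.exists_indiscernible [Nonempty M] {μ : Cardinal.{w}}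
    (hM : IsSaturated L M μ) {β α J : Type*} [LinearOrder J]
    (hJ : Cardinal.lift.{w} #(β ⊕ J × α) < Cardinal.lift μ) (b : β → M) (c : ℕ → α → M) :
    ∃ (b' : β → M) (c' : J → α → M),
      (∀ (r : ℕ) (φ : L.Formula (β ⊕ Fin r × α)) (i j : Fin r → J), StrictMono i → StrictMono j →
        (φ.Realize (Sum.elim b' (rowTuple c' i)) ↔ φ.Realize (Sum.elim b' (rowTuple c' j)))) ∧
      ∀ (r : ℕ) (φ : L.Formula (β ⊕ Fin r × α)),
        (∀ i : Fin r → ℕ, StrictMono i → φ.Realize (Sum.elim b (rowTuple c i))) →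
          ∀ i : Fin r → J, StrictMono i → φ.Realize (Sum.elim b' (rowTuple c' i)) := by
  classical
  choose h hh hhom using fun Δ : Finset (Σ r, L.Formula (β ⊕ Fin r × α)) =>
    exists_strictMono_forall_homogeneous (fun k : Σ r, L.Formula (β ⊕ Fin r × α) => k.1)
      (fun k t => k.2.Realize (Sum.elim b (rowTuple c t))) Δ
  -- `pos F` embeds the finite set `F` into the natural numbers, preserving the order
  let pos (F : Finset J) (j : J) : ℕ := (F.filter (· < j)).card
  have hpos (F : Finset J) {r : ℕ} (i : Fin r → J) (hi : StrictMono i) (hF : ∀ l, i l ∈ F) :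
      StrictMono (pos F ∘ i) := by
    intro l l' hl
    refine Finset.card_lt_card (Finset.ssubset_iff_of_subset ?_ |>.2 ⟨i l, ?_, ?_⟩)
    · intro k hk
      rw [Finset.mem_filter] at hk ⊢
      exact ⟨hk.1, hk.2.trans (hi hl)⟩
    · exact Finset.mem_filter.2 ⟨hF l, hi hl⟩
    · simp
  let x (D : Finset (Σ r, L.Formula (β ⊕ Fin r × α)) × Finset J) : β ⊕ J × α → M :=
    Sum.elim b fun p => c (h D.1 (pos D.2 p.1)) p.2
  obtain ⟨y, hy⟩ := hM.exists_realize rfl hJ (map x atTop)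
  have hx (D) {r : ℕ} (i : Fin r → J) : x D ∘ Sum.map id (fun p : Fin r × α => (i p.1, p.2)) =
      Sum.elim b (rowTuple c (h D.1 ∘ pos D.2 ∘ i)) := by
    ext (k | k) <;> rfl
  have hyi {r : ℕ} (i : Fin r → J) : y ∘ Sum.map id (fun p : Fin r × α => (i p.1, p.2)) =
      Sum.elim (y ∘ Sum.inl) (rowTuple (fun j k => y (Sum.inr (j, k))) i) := by
    ext (k | k) <;> rfl
  have hF {r : ℕ} (i : Fin r → J) : ∀ᶠ D : Finset (Σ r, L.Formula (β ⊕ Fin r × α)) × Finset J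
      in atTop, ∀ l, i l ∈ D.2 := by
    filter_upwards [eventually_ge_atTop ((∅, Finset.univ.image i) :
      Finset (Σ r, L.Formula (β ⊕ Fin r × α)) × Finset J)] with D hD l
    exact hD.2 (Finset.mem_image_of_mem _ (Finset.mem_univ l))
  refine ⟨y ∘ Sum.inl, fun j k => y (Sum.inr (j, k)), fun r φ i j hi hj => ?_,
    fun r φ hφ i hi => ?_⟩
  · have h1 := hy ((φ.relabel (Sum.map id fun p : Fin r × α => (i p.1, p.2))).iff
      (φ.relabel (Sum.map id fun p : Fin r × α => (j p.1, p.2)))) (by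
        rw [eventually_map]
        filter_upwards [hF i, hF j, eventually_ge_atTop (({⟨r, φ⟩}, ∅) :
          Finset (Σ r, L.Formula (β ⊕ Fin r × α)) × Finset J)] with D hDi hDj hD
        rw [Formula.realize_iff, Formula.realize_relabel, Formula.realize_relabel, hx, hx]
        exact hhom D.1 ⟨r, φ⟩ (hD.1 (Finset.mem_singleton_self _)) _ _ (hpos _ i hi hDi)
          (hpos _ j hj hDj))
    rwa [Formula.realize_iff, Formula.realize_relabel, Formula.realize_relabel, hyi, hyi] at h1
  · have h1 := hy (φ.relabel (Sum.map id fun p : Fin r × α => (i p.1, p.2))) (by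
      rw [eventually_map]
      filter_upwards [hF i] with D hDi
      rw [Formula.realize_relabel, hx]
      exact hφ _ ((hh D.1).comp (hpos _ i hi hDi)))
    rwa [Formula.realize_relabel, hyi] at h1

end Indiscernible

/-! ### SOP₁ trees in small models -/

section Transfer

variable {L : FirstOrder.Language.{u, v}} {M : Type w} [L.Structure M]

/-- The formula saying that finitely many instances of `φ` are jointly satisfiable. -/
noncomputable def jointlySatisfiable {n m : ℕ} (φ : L.Formula (Fin n ⊕ Fin m)) {ι : Type*}
    [Finite ι] : L.Formula (ι × Fin m) :=
  (Formula.iInf fun i : ι =>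
    φ.relabel (Sum.elim Sum.inr fun k => Sum.inl (i, k))).iExs (Fin n)

theorem realize_jointlySatisfiable {n m : ℕ} {φ : L.Formula (Fin n ⊕ Fin m)} {ι : Type*}
    [Finite ι] {y : ι × Fin m → M} :
    (jointlySatisfiable φ).Realize y ↔
      ∃ x : Fin n → M, ∀ i, φ.Realize (Sum.elim x fun k => y (i, k)) := by
  rw [jointlySatisfiable, Formula.realize_iExs]
  refine exists_congr fun x => ?_
  rw [Formula.realize_iInf]
  refine forall_congr' fun i => ?_
  rw [Formula.realize_relabel]
  refine iff_of_eq (congrArg φ.Realize ?_)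
  ext (k | k) <;> rfl

theorem consistent_iff_realize {n m : ℕ} {φ : L.Formula (Fin n ⊕ Fin m)} {ι : Type*}
    {a : ι → Fin m → M} :
    Consistent φ a ↔ ∀ F : Finset ι,
      (jointlySatisfiable φ).Realize fun p : F × Fin m => a p.1 p.2 := by
  refine forall_congr' fun F => ?_
  rw [realize_jointlySatisfiable]
  simp

/-- Elementary embeddings preserve and reflect consistency. -/
theorem consistent_map_iff {N : Type*} [L.Structure N] (f : N ↪ₑ[L] M) {n m : ℕ}
    {φ : L.Formula (Fin n ⊕ Fin m)} {ι : Type*} {a : ι → Fin m → N} :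
    Consistent φ (fun i => f ∘ a i) ↔ Consistent φ a := by
  rw [consistent_iff_realize, consistent_iff_realize]
  refine forall_congr' fun F => ?_
  rw [← f.map_formula]
  rfl

/-- An NSOP₁ theory has no model, of any size, with an SOP₁ tree: a small elementary substructure
contains the tree. -/
theorem IsNSOP₁.not_hasSOP₁ {T : L.Theory} (hT : IsNSOP₁ T) [Nonempty M] [M ⊨ T] {n m : ℕ}
    (φ : L.Formula (Fin n ⊕ Fin m)) : ¬ HasSOP₁ M φ := by
  rintro ⟨a, ha1, ha2⟩
  let s : Set M := Set.range fun p : List (Fin 2) × Fin m => a p.1 p.2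
  have hs : #s ≤ ℵ₀ := Cardinal.mk_le_aleph0_iff.2 (Set.countable_range _)
  obtain ⟨S, hsS, hS⟩ : ∃ S : L.ElementarySubstructure M, s ⊆ S ∧ Small.{max u v} S := by
    rcases le_total (Cardinal.lift.{w} (max L.card ℵ₀)) (Cardinal.lift.{max u v} #M) with h | h
    · obtain ⟨S, hsS, hS⟩ := exists_elementarySubstructure_card_eq L s (max L.card ℵ₀)
        (le_max_right _ _)
        ((Cardinal.lift_le.2 hs).trans (by simp)) (by simp) h
      refine ⟨S, hsS, ?_⟩
      rw [← Cardinal.mk_out (max L.card ℵ₀)] at hS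
      obtain ⟨e⟩ := Cardinal.lift_mk_eq'.1 hS
      exact small_of_injective e.injective
    · rw [← Cardinal.mk_out (max L.card ℵ₀)] at h
      obtain ⟨e⟩ := Cardinal.lift_mk_le'.1 h
      have : Small.{max u v} M := small_of_injective e.injective
      exact ⟨⊤, by simp, inferInstance⟩
  let e := equivShrink S
  let N : Theory.ModelType.{u, v, max u v} T := (Theory.ModelType.of T S).shrink
  let g : S ≃[L] N := e.inducedStructureEquiv
  let f : N ↪ₑ[L] M := S.subtype.comp g.symm.toElementaryEmbedding
  let a' : List (Fin 2) → Fin m → N := fun η k => g ⟨a η k, hsS ⟨(η, k), rfl⟩⟩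
  have hf (η : List (Fin 2)) : f ∘ a' η = a η := by
    ext k
    change ((g.symm (g _) : S) : M) = _
    rw [g.symm_apply_apply]
  refine hT N n m φ ⟨a', fun η => ?_, fun ξ ν h => ?_⟩
  · rw [← consistent_map_iff f]
    simpa only [hf] using ha1 η
  · rw [← consistent_map_iff f]
    have h1 : (fun i => f ∘ ![a' (ξ ++ [1]), a' ν] i) = ![a (ξ ++ [1]), a ν] := by
      ext i : 1
      fin_cases i
      · exact hf _
      · exact hf _
    rw [h1]
    exact ha2 ξ ν h

end Transfer

/-! ### From arrays to SOP₁ trees -/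

section Tree

variable {L : FirstOrder.Language.{u, v}} {M : Type w} [L.Structure M]

/-- The automorphism attached to a node `η` of the binary tree, when the root has height `k`:
the composition of the maps `σ (l + 1)` over the heights `l` at which `η` turns to the right. -/
def treeEquiv (σ : ℕ → M ≃[L] M) : ℕ → List (Fin 2) → M ≃[L] M
  | _, [] => Language.Equiv.refl L M
  | k, e :: η => if e = 1 then (σ (k + 1)).comp (treeEquiv σ (k + 1) η) else treeEquiv σ (k + 1) η

theorem treeEquiv_append (σ : ℕ → M ≃[L] M) (k : ℕ) (ξ ρ : List (Fin 2)) (y : M) :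
    treeEquiv σ k (ξ ++ ρ) y = treeEquiv σ k ξ (treeEquiv σ (k + ξ.length) ρ y) := by
  induction ξ generalizing k with
  | nil => simp [treeEquiv]
  | cons e ξ ih =>
    have h : k + (e :: ξ).length = k + 1 + ξ.length := by simp; omega
    rw [List.cons_append, treeEquiv, treeEquiv, h]
    split_ifs
    · rw [Language.Equiv.comp_apply, ih, Language.Equiv.comp_apply]
    · exact ih (k + 1)

theorem treeEquiv_apply_eq (σ : ℕ → M ≃[L] M) (k : ℕ) (ρ : List (Fin 2)) {y : M}
    (h : ∀ l, k < l → σ l y = y) : treeEquiv σ k ρ y = y := by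
  induction ρ generalizing k with
  | nil => simp [treeEquiv]
  | cons e ρ ih =>
    have h1 := ih (k + 1) fun l hl => h l (by omega)
    rw [treeEquiv]
    split_ifs
    · rw [Language.Equiv.comp_apply, h1, h _ (by omega)]
    · exact h1

theorem realize_comp_equiv {n m : ℕ} (φ : L.Formula (Fin n ⊕ Fin m)) (σ : M ≃[L] M)
    {x : Fin n → M} {y : Fin m → M} :
    φ.Realize (Sum.elim (σ ∘ x) (σ ∘ y)) ↔ φ.Realize (Sum.elim x y) := by
  rw [← Sum.comp_elim, StrongHomClass.realize_formula]

theorem branchRestrict_add (η : ℕ → Fin 2) (k d : ℕ) :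
    ∃ ρ, branchRestrict η (k + d) = branchRestrict η k ++ ρ :=
  ⟨_, List.ofFn_add⟩

theorem length_branchRestrict (η : ℕ → Fin 2) (k : ℕ) : (branchRestrict η k).length = k :=
  List.length_ofFn

/-- An indiscernible array `c` whose two entries in a row are conjugate over the earlier rows
yields an SOP₁ tree, if some `b` satisfies all instances of `φ` in the column `0` while the
instances in the column `1` are inconsistent. -/
theorem exists_hasSOP₁_of_array {n m : ℕ} (φ : L.Formula (Fin n ⊕ Fin m))
    (c : ℕ → Fin 2 → Fin m → M)
    (hσ : ∀ i, ∃ σ : M ≃[L] M, (∀ j < i, ∀ e k, σ (c j e k) = c j e k) ∧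
      ∀ k, σ (c i 0 k) = c i 1 k)
    (hind : ∀ (r : ℕ) (ψ : L.Formula (Fin r × Fin 2 × Fin m)) (i j : Fin r → ℕ), StrictMono i →
      StrictMono j → ((ψ.Realize fun p => c (i p.1) p.2.1 p.2.2) ↔
        ψ.Realize fun p => c (j p.1) p.2.1 p.2.2))
    (b : Fin n → M) (hb : ∀ i, φ.Realize (Sum.elim b (c i 0)))
    (k : ℕ) (hk : ¬ ∃ x : Fin n → M, ∀ i < k, φ.Realize (Sum.elim x (c i 1))) :
    ∃ (m' : ℕ) (φ' : L.Formula (Fin n ⊕ Fin m')), HasSOP₁ M φ' := by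
  -- whether a word of zeros and ones is consistent does not depend on the rows
  have hword (r : ℕ) (w : Fin r → Fin 2) (i j : Fin r → ℕ) (hi : StrictMono i)
      (hj : StrictMono j) : (∃ x : Fin n → M, ∀ l, φ.Realize (Sum.elim x (c (i l) (w l)))) →
        ∃ x : Fin n → M, ∀ l, φ.Realize (Sum.elim x (c (j l) (w l))) := by
    have h1 := hind r ((jointlySatisfiable φ (ι := Fin r)).relabel fun p => (p.1, w p.1, p.2))
      i j hi hj
    rw [Formula.realize_relabel, Formula.realize_relabel, realize_jointlySatisfiable,
      realize_jointlySatisfiable] at h1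
    exact h1.1
  -- the longest initial word of ones that is consistent with arbitrarily many zeros after it
  let P (q : ℕ) : Prop := ∀ N, ∃ x : Fin n → M, (∀ i < q, φ.Realize (Sum.elim x (c i 1))) ∧
    ∀ i, q ≤ i → i < q + N → φ.Realize (Sum.elim x (c i 0))
  obtain ⟨q, hq, N, hN⟩ : ∃ q, P q ∧ ∃ N, ¬ ∃ x : Fin n → M,
      (∀ i < q + 1, φ.Realize (Sum.elim x (c i 1))) ∧
        ∀ i, q + 1 ≤ i → i < q + 1 + N → φ.Realize (Sum.elim x (c i 0)) := by
    by_contra! hcon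
    have hP (q : ℕ) : P q := by
      induction q with
      | zero => exact fun N => ⟨b, by simp, fun i _ _ => hb i⟩
      | succ q ih => exact hcon q ih
    obtain ⟨x, hx, -⟩ := hP k 0
    exact hk ⟨x, hx⟩
  have hincon (i : Fin (q + 1 + N) → ℕ) (hi : StrictMono i) : ¬ ∃ x : Fin n → M,
      ∀ l, φ.Realize (Sum.elim x (c (i l) (if l.1 < q + 1 then 1 else 0))) := by
    intro h
    obtain ⟨x, hx⟩ := hword _ _ i Fin.val hi Fin.val_strictMono h
    refine hN ⟨x, fun i hi => ?_, fun i hi hi' => ?_⟩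
    · simpa [hi] using hx ⟨i, by omega⟩
    · simpa [not_lt.2 hi] using hx ⟨i, hi'⟩
  choose s hs1 hs2 using hσ
  -- after the rows below `q`, the rows are grouped into blocks of length `B`
  set B := N + 1 with hB
  let σ (l : ℕ) : M ≃[L] M := s (q + l * B)
  let τ (η : List (Fin 2)) : M ≃[L] M := treeEquiv σ 0 η
  let row (l : ℕ) (p : Fin (q + B)) : ℕ := if p.1 < q then p.1 else p.1 + l * B
  let bit (p : Fin (q + B)) : Fin 2 := if p.1 < q then 1 else 0
  let e : Fin (q + B) × Fin m ≃ Fin ((q + B) * m) := finProdFinEquiv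
  let a (η : List (Fin 2)) : Fin ((q + B) * m) → M := fun y =>
    τ η (c (row η.length (e.symm y).1) (bit (e.symm y).1) (e.symm y).2)
  let φ' : L.Formula (Fin n ⊕ Fin ((q + B) * m)) :=
    Formula.iInf fun p => φ.relabel (Sum.map id fun k => e (p, k))
  have hφ' (x : Fin n → M) (η : List (Fin 2)) : φ'.Realize (Sum.elim x (a η)) ↔
      ∀ p, φ.Realize (Sum.elim x (τ η ∘ c (row η.length p) (bit p))) := by
    rw [Formula.realize_iInf]
    refine forall_congr' fun p => ?_
    rw [Formula.realize_relabel]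
    refine iff_of_eq (congrArg φ.Realize ?_)
    ext (k | k)
    · rfl
    · simp [a]
  have hfix (k : ℕ) (ρ : List (Fin 2)) (j : ℕ) (hj : j < q + (k + 1) * B) (e : Fin 2)
      (y : Fin m) : treeEquiv σ k ρ (c j e y) = c j e y := by
    refine treeEquiv_apply_eq σ k ρ fun l hl => hs1 _ j (hj.trans_le ?_) e y
    exact Nat.add_le_add_left (Nat.mul_le_mul_right B hl) q
  have hrow (l : ℕ) (p : Fin (q + B)) : row l p < q + (l + 1) * B := by
    have := p.2
    simp only [row]
    split_ifs
    · omega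
    · rw [Nat.add_mul, one_mul]; omega
  refine ⟨_, φ', a, fun η F => ?_, fun ξ ν hν hcon => ?_⟩
  · obtain ⟨K, hK⟩ : ∃ K, ∀ l ∈ F, l ≤ K := F.exists_le
    obtain ⟨x, hx1, hx0⟩ := hq ((K + 1) * B)
    refine ⟨τ (branchRestrict η K) ∘ x, fun l hl => (hφ' _ _).2 fun p => ?_⟩
    obtain ⟨d, rfl⟩ := Nat.exists_eq_add_of_le (hK l hl)
    obtain ⟨ρ, hρ⟩ := branchRestrict_add η l d
    rw [length_branchRestrict]
    have h1 : τ (branchRestrict η l) ∘ c (row l p) (bit p) =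
        τ (branchRestrict η (l + d)) ∘ c (row l p) (bit p) := by
      ext y
      simp only [τ, Function.comp_apply]
      rw [hρ, treeEquiv_append, length_branchRestrict, zero_add, hfix l ρ _ (hrow l p)]
    rw [h1, realize_comp_equiv]
    by_cases hp : p.1 < q
    · simpa [row, bit, hp] using hx1 p hp
    · have h2 := hx0 (row l p) (by simp only [row, hp, if_false]; omega)
        ((hrow l p).trans_le (Nat.add_le_add_left (Nat.mul_le_mul_right B (by omega)) q))
      simpa [bit, hp] using h2
  · obtain ⟨ρ, rfl⟩ := hν
    obtain ⟨x, hx⟩ := hcon Finset.univ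
    have hx0 := (hφ' x _).1 (hx 0 (Finset.mem_univ _))
    have hx1 := (hφ' x _).1 (hx 1 (Finset.mem_univ _))
    set ν := ξ ++ [0] ++ ρ with hν
    set k := ξ.length with hk
    have hlen : ν.length = k + 1 + ρ.length := by simp [hν, hk]; omega
    have hτ1 (y : Fin m) : τ (ξ ++ [1]) (c (q + (k + 1) * B) 0 y) =
        τ ν (c (q + (k + 1) * B) 1 y) := by
      have h1 : treeEquiv σ (k + 1) ρ (c (q + (k + 1) * B) 1 y) = c (q + (k + 1) * B) 1 y :=
        hfix (k + 1) ρ _ (by rw [Nat.add_mul (k + 1), one_mul]; omega) 1 y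
      have h2 : τ ν (c (q + (k + 1) * B) 1 y) = τ ξ (c (q + (k + 1) * B) 1 y) := by
        simp only [τ, hν]
        rw [List.append_assoc, treeEquiv_append, zero_add, List.singleton_append, treeEquiv,
          if_neg (by simp), h1]
      rw [h2]
      simp only [τ]
      rw [treeEquiv_append, zero_add, treeEquiv, if_pos rfl, Language.Equiv.comp_apply, treeEquiv,
        Language.Equiv.refl_apply]
      exact congrArg _ (hs2 _ y)
    have hle : (k + 1) * B ≤ ν.length * B := Nat.mul_le_mul_right B (by omega)
    refine hincon (fun l => if l.1 < q then l.1 else if l.1 = q then q + (k + 1) * B else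
      l.1 + ν.length * B) ?_ ⟨(τ ν).symm ∘ x, fun l => ?_⟩
    · intro l l' (hl : l.1 < l'.1)
      dsimp only
      split_ifs <;> omega
    · have h0 : x = τ ν ∘ (τ ν).symm ∘ x := by
        ext y
        exact ((τ ν).apply_symm_apply (x y)).symm
      rw [← realize_comp_equiv φ (τ ν), ← h0]
      rcases lt_trichotomy l.1 q with h | h | h
      · have h1 := hx1 ⟨l.1, by omega⟩
        simp only [row, bit, if_pos h] at h1
        simpa only [if_pos h, if_pos (h.trans (Nat.lt_succ_self q))] using h1
      · have h1 := hx0 ⟨q, by omega⟩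
        simp only [row, bit, lt_irrefl, if_false, List.length_append, List.length_singleton] at h1
        have h2 : τ (ξ ++ [1]) ∘ c (q + (k + 1) * B) 0 = τ ν ∘ c (q + (k + 1) * B) 1 :=
          funext hτ1
        rw [h2] at h1
        simpa only [h, lt_irrefl, if_false, if_true, Nat.lt_succ_self] using h1
      · have h1 := hx1 ⟨l.1, by omega⟩
        simp only [row, bit, if_neg h.not_gt] at h1
        have h2 : ¬ l.1 < q + 1 := by omega
        simpa only [if_neg h.not_gt, if_neg h.ne', if_neg h2] using h1

end Tree

/-! ### From SOP₁ trees to arrays -/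

section Array

variable {L : FirstOrder.Language.{u, v}}

/-- The rows of an array are read off along a path `η` in a binary tree: the node of the column `1`
in a row turns right where the node of the column `0` turns left, and all later nodes lie above
the latter. Finitely many formulas do not distinguish the two nodes over the earlier rows, by the
pigeonhole principle applied to the infinitely many nodes `η ⌢ 0 ⋯ 0 ⌢ 1`. -/
theorem exists_treeNodes {N : Type*} [L.Structure N] {m : ℕ} (a : List (Fin 2) → Fin m → N)
    (Δ : Finset (Σ i : ℕ, L.Formula ((Fin i × Fin 2 × Fin m) ⊕ Fin m))) (K : ℕ) :
    ∃ (s : ℕ → Fin 2 → List (Fin 2)) (η : List (Fin 2)),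
      (∀ i < K, s i 0 <+: η) ∧ (∀ j < K, ∀ i < j, ∀ e, s i 0 <+: s j e) ∧
      (∀ i < K, ∃ ξ, s i 1 = ξ ++ [1] ∧ ξ ++ [0] <+: s i 0) ∧
      ∀ d ∈ Δ, d.1 < K →
        (d.2.Realize (Sum.elim (fun p => a (s p.1 p.2.1) p.2.2) (a (s d.1 0))) ↔
          d.2.Realize (Sum.elim (fun p => a (s p.1 p.2.1) p.2.2) (a (s d.1 1)))) := by
  classical
  induction K with
  | zero => exact ⟨fun _ _ => [], [], by simp, by simp, by simp, by simp⟩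
  | succ K ih =>
    obtain ⟨s, η, h1, h2, h3, h4⟩ := ih
    let node (j : ℕ) : List (Fin 2) := η ++ List.replicate j 0 ++ [1]
    let f (j : ℕ) : Δ → Prop := fun d =>
      d.1.2.Realize (Sum.elim (fun p => a (s p.1 p.2.1) p.2.2) (a (node j)))
    obtain ⟨j, j', hjj, hf⟩ : ∃ j j', j < j' ∧ f j = f j' := by
      obtain ⟨j, j', hne, hf⟩ := Finite.exists_ne_map_eq_of_infinite f
      rcases lt_or_gt_of_ne hne with h | h
      · exact ⟨j, j', h, hf⟩
      · exact ⟨j', j, h, hf.symm⟩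
    let s' : ℕ → Fin 2 → List (Fin 2) := Function.update s K ![node j', node j]
    have hs' {i : ℕ} (hi : i < K) : s' i = s i := Function.update_of_ne hi.ne _ _
    have hK0 : s' K 0 = node j' := by simp [s']
    have hK1 : s' K 1 = node j := by simp [s']
    have hη (j : ℕ) : η <+: node j := by simp [node, List.append_assoc]
    refine ⟨s', node j', fun i hi => ?_, fun l hl i hi e => ?_, fun i hi => ?_,
      fun d hd hdK => ?_⟩
    · rcases Nat.lt_succ_iff_lt_or_eq.1 hi with hi | rfl
      · rw [hs' hi]
        exact (h1 i hi).trans (hη j')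
      · rw [hK0]
    · rcases Nat.lt_succ_iff_lt_or_eq.1 hl with hl | rfl
      · rw [hs' hl, hs' (hi.trans hl)]
        exact h2 l hl i hi e
      · rw [hs' hi]
        refine (h1 i hi).trans ?_
        fin_cases e
        · exact hK0 ▸ hη j'
        · exact hK1 ▸ hη j
    · rcases Nat.lt_succ_iff_lt_or_eq.1 hi with hi | rfl
      · rw [hs' hi]
        exact h3 i hi
      · refine ⟨η ++ List.replicate j 0, hK1, ?_⟩
        rw [hK0]
        obtain ⟨d, rfl⟩ := Nat.exists_eq_add_of_lt hjj
        refine ⟨List.replicate d 0 ++ [1], ?_⟩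
        simp only [node, List.append_assoc, List.append_cancel_left_eq]
        rw [show j + d + 1 = j + (1 + d) by omega, List.replicate_add, List.replicate_add]
        simp
    · have hrows : (fun p : Fin d.1 × Fin 2 × Fin m => a (s' p.1 p.2.1) p.2.2) =
          fun p => a (s p.1 p.2.1) p.2.2 := by
        ext p
        rw [hs' (p.1.2.trans_le (Nat.lt_succ_iff.1 hdK))]
      rw [hrows]
      rcases Nat.lt_succ_iff_lt_or_eq.1 hdK with hi | hi
      · rw [hs' hi]
        exact h4 d hd hi
      · have e0 : s' d.1 0 = node j' := hi ▸ hK0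
        have e1 : s' d.1 1 = node j := hi ▸ hK1
        rw [e0, e1]
        exact (iff_of_eq (congrFun hf ⟨d, hd⟩)).symm

/-- Every binary string lies on an infinite branch. -/
theorem exists_branchRestrict_eq (η : List (Fin 2)) :
    ∃ β : ℕ → Fin 2, ∀ ξ, ξ <+: η → ξ = branchRestrict β ξ.length := by
  refine ⟨fun i => η.getD i 0, ?_⟩
  rintro ξ ⟨ρ, rfl⟩
  refine List.ext_getElem (by simp [branchRestrict]) fun i h _ => ?_
  simp [branchRestrict, List.getElem?_append_left h, List.getElem?_eq_getElem h]

variable {M : Type w} [L.Structure M]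

/-- An SOP₁ tree yields an array whose two entries in a row have the same type over the earlier
rows, where the instances of `φ` are jointly realized in the column `0` and pairwise inconsistent
in the column `1`. -/
theorem IsSaturated.exists_array_of_hasSOP₁ [Nonempty M] {μ : Cardinal.{w}}
    (hM : IsSaturated L M μ) (hμ : ℵ₀ < μ) {N : Type*} [L.Structure N] (hNM : N ≅[L] M)
    {n m : ℕ} {φ : L.Formula (Fin n ⊕ Fin m)} (hφ : HasSOP₁ N φ) :
    ∃ (b : Fin n → M) (c : ℕ → Fin 2 → Fin m → M), (∀ i, φ.Realize (Sum.elim b (c i 0))) ∧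
      (∀ i j, i < j → ¬ ∃ x : Fin n → M, φ.Realize (Sum.elim x (c i 1)) ∧
        φ.Realize (Sum.elim x (c j 1))) ∧
      ∀ (i : ℕ) (θ : L.Formula ((Fin i × Fin 2 × Fin m) ⊕ Fin m)),
        θ.Realize (Sum.elim (fun p => c p.1 p.2.1 p.2.2) (c i 0)) ↔
          θ.Realize (Sum.elim (fun p => c p.1 p.2.1 p.2.2) (c i 1)) := by
  classical
  obtain ⟨a, ha1, ha2⟩ := hφ
  choose s η h1 h2 h3 h4 using fun D : Finset
    (Σ i : ℕ, L.Formula ((Fin i × Fin 2 × Fin m) ⊕ Fin m)) × ℕ => exists_treeNodes a D.1 D.2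
  have hb (D : Finset (Σ i : ℕ, L.Formula ((Fin i × Fin 2 × Fin m) ⊕ Fin m)) × ℕ) :
      ∃ b : Fin n → N, ∀ i < D.2, φ.Realize (Sum.elim b (a (s D i 0))) := by
    obtain ⟨β, hβ⟩ := exists_branchRestrict_eq (η D)
    obtain ⟨b, hb⟩ := ha1 β ((Finset.range D.2).image fun i => (s D i 0).length)
    refine ⟨b, fun i hi => ?_⟩
    rw [hβ _ (h1 D i hi)]
    exact hb _ (Finset.mem_image_of_mem _ (Finset.mem_range.2 hi))
  choose b hb using hb
  have hI : Cardinal.lift.{w} #(Fin n ⊕ ℕ × Fin 2 × Fin m) < Cardinal.lift.{0} μ := by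
    have h0 : #(Fin n ⊕ ℕ × Fin 2 × Fin m) ≤ ℵ₀ := Cardinal.mk_le_aleph0
    rw [Cardinal.lift_uzero]
    exact (Cardinal.lift_le_aleph0.2 h0).trans_lt hμ
  let x (D : Finset (Σ i : ℕ, L.Formula ((Fin i × Fin 2 × Fin m) ⊕ Fin m)) × ℕ) :
      Fin n ⊕ ℕ × Fin 2 × Fin m → N := Sum.elim (b D) fun p => a (s D p.1 p.2.1) p.2.2
  obtain ⟨y, hy⟩ := hM.exists_realize hNM hI (map x atTop)
  have hK (K : ℕ) : ∀ᶠ D : Finset (Σ i : ℕ, L.Formula ((Fin i × Fin 2 × Fin m) ⊕ Fin m)) × ℕ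
      in atTop, K ≤ D.2 :=
    (eventually_ge_atTop ((∅, K) :
      Finset (Σ i : ℕ, L.Formula ((Fin i × Fin 2 × Fin m) ⊕ Fin m)) × ℕ)).mono fun D hD => hD.2
  refine ⟨y ∘ Sum.inl, fun i e k => y (Sum.inr (i, e, k)), fun i => ?_, fun i j hij => ?_,
    fun i θ => ?_⟩
  · have := hy (φ.relabel (Sum.map id fun k => (i, 0, k))) (by
      rw [eventually_map]
      filter_upwards [hK (i + 1)] with D hD
      rw [Formula.realize_relabel]
      convert! hb D i hD using 1
      ext (k | k) <;> rfl)
    rw [Formula.realize_relabel] at this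
    convert! this using 1
    ext (k | k) <;> rfl
  · have := hy ((jointlySatisfiable φ (ι := Fin 2)).relabel
        fun p => Sum.inr (if p.1 = 0 then i else j, 1, p.2)).not (by
      rw [eventually_map]
      filter_upwards [hK (j + 1)] with D hD
      rw [Formula.realize_not, Formula.realize_relabel, realize_jointlySatisfiable]
      rintro ⟨z, hz⟩
      obtain ⟨ξ, hξ, hξ'⟩ := h3 D i (hij.trans hD)
      refine ha2 ξ (s D j 1) (hξ'.trans (h2 D j hD i hij 1)) fun F => ⟨z, fun l _ => ?_⟩
      have h5 := hz l
      fin_cases l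
      · rw [← hξ]
        exact h5
      · exact h5)
    rw [Formula.realize_not, Formula.realize_relabel, realize_jointlySatisfiable] at this
    rintro ⟨z, hz1, hz2⟩
    refine this ⟨z, fun l => ?_⟩
    fin_cases l
    · exact hz1
    · exact hz2
  · have := hy ((θ.relabel (Sum.elim (fun p => Sum.inr (p.1.1, p.2.1, p.2.2))
        fun k => Sum.inr (i, 0, k))).iff (θ.relabel (Sum.elim
          (fun p => Sum.inr (p.1.1, p.2.1, p.2.2)) fun k => Sum.inr (i, 1, k)))) (by
      rw [eventually_map]
      filter_upwards [hK (i + 1), eventually_ge_atTop (({⟨i, θ⟩}, 0) :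
        Finset (Σ i : ℕ, L.Formula ((Fin i × Fin 2 × Fin m) ⊕ Fin m)) × ℕ)] with D hD hD'
      rw [Formula.realize_iff, Formula.realize_relabel, Formula.realize_relabel]
      convert! h4 D ⟨i, θ⟩ (hD'.1 (Finset.mem_singleton_self _)) hD using 2
      all_goals ext (k | k) <;> rfl)
    rw [Formula.realize_iff, Formula.realize_relabel, Formula.realize_relabel] at this
    convert! this using 2
    all_goals ext (k | k) <;> rfl

end Array

/-! ### Indiscernibility and types in terms of formulas -/

section FormulaCriteria

variable {L : FirstOrder.Language.{u, v}} {M : Type w} [L.Structure M] [Nonempty M]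

/-- Indiscernibility over any parameters implies that increasing tuples of rows satisfy the same
formulas without parameters. -/
theorem IsIndiscernibleOver.realize_iff {A : Set M} {J α : Type*} [LinearOrder J]
    {c : J → α → M} (h : IsIndiscernibleOver L A c) {r : ℕ} (φ : L.Formula (Fin r × α))
    {i j : Fin r → J} (hi : StrictMono i) (hj : StrictMono j) :
    φ.Realize (rowTuple c i) ↔ φ.Realize (rowTuple c j) := by
  have h1 := tpOver_eq_iff.1 (h r i j hi hj) (φ.relabel Sum.inr)
  rwa [Formula.realize_relabel, Formula.realize_relabel] at h1

/-- Indiscernibility over a set of coordinates of a tuple `b` can be tested on formulas in the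
variables of `b`. -/
theorem isIndiscernibleOver_of_subset_range {β J α : Type*} [LinearOrder J] {b : β → M}
    {c : J → α → M} (h : ∀ (r : ℕ) (φ : L.Formula (β ⊕ Fin r × α)) (i j : Fin r → J),
      StrictMono i → StrictMono j →
        (φ.Realize (Sum.elim b (rowTuple c i)) ↔ φ.Realize (Sum.elim b (rowTuple c j))))
    {A : Set M} (hA : A ⊆ Set.range b) : IsIndiscernibleOver L A c := by
  intro r i j hi hj
  choose g hg using fun a : A => hA a.2
  have h1 (t : Fin r × α → M) :
      (Sum.elim b t) ∘ Sum.map g id = Sum.elim (fun a : A => (a : M)) t := by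
    ext (a | k)
    · exact hg a
    · rfl
  refine tpOver_eq_iff.2 fun φ => ?_
  have h2 := h r (φ.relabel (Sum.map g id)) i j hi hj
  rwa [Formula.realize_relabel, Formula.realize_relabel, h1, h1] at h2

/-- Equality of types over the earlier rows can be tested on finitely many rows at a time. -/
theorem tpOver_rowsBelow_eq {J : Type*} [LinearOrder J] {m : ℕ} {c : J → Fin 2 → Fin m → M} {i : J}
    (h : ∀ (r : ℕ) (l : Fin r → J), StrictMono l → (∀ k, l k < i) →
      ∀ θ : L.Formula ((Fin r × Fin 2 × Fin m) ⊕ Fin m),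
        θ.Realize (Sum.elim (fun p => c (l p.1) p.2.1 p.2.2) (c i 0)) ↔
          θ.Realize (Sum.elim (fun p => c (l p.1) p.2.1 p.2.2) (c i 1))) :
    tpOver L (∅ ∪ rowsBelow c i) (c i 0) = tpOver L (∅ ∪ rowsBelow c i) (c i 1) := by
  classical
  refine tpOver_eq_iff.2 fun φ => ?_
  have hA : ∀ a : (∅ ∪ rowsBelow c i : Set M),
      ∃ j < i, ∃ (e : Fin 2) (k : Fin m), (a : M) = c j e k := fun a => by
    exact a.2.resolve_left (Set.notMem_empty _)
  choose j hj e k hjek using hA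
  let F : Finset J := φ.freeVarFinset.toLeft.image j
  let l : Fin F.card ↪o J := F.orderEmbOfFin rfl
  let f : φ.freeVarFinset → (Fin F.card × Fin 2 × Fin m) ⊕ Fin m := fun z =>
    match z with
    | ⟨Sum.inl a, ha⟩ => Sum.inl ((F.orderIsoOfFin rfl).symm
        ⟨j a, Finset.mem_image_of_mem _ (Finset.mem_toLeft.2 ha)⟩, e a, k a)
    | ⟨Sum.inr y, _⟩ => Sum.inr y
  have hf (t : Fin m → M) (z : φ.freeVarFinset) :
      Sum.elim (fun p : Fin F.card × Fin 2 × Fin m => c (l p.1) p.2.1 p.2.2) t (f z) =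
        Sum.elim (fun a : (∅ ∪ rowsBelow c i : Set M) => (a : M)) t z := by
    rcases z with ⟨a | y, ha⟩
    · simp only [f, l, Sum.elim_inl, ← Finset.coe_orderIsoOfFin_apply, OrderIso.apply_symm_apply]
      exact (hjek a).symm
    · rfl
  rw [← realize_restrictFreeVar_iff f (hf (c i 0)), ← realize_restrictFreeVar_iff f (hf (c i 1))]
  refine h _ l l.strictMono (fun y => ?_) _
  obtain ⟨a, -, ha⟩ := Finset.mem_image.1 (F.orderEmbOfFin_mem rfl y)
  exact ha ▸ hj a

end FormulaCriteria

/-! ### Realizing a type along an indiscernible sequence -/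

section Realization

variable {L : FirstOrder.Language.{u, v}} {M : Type w} [L.Structure M]

/-- A sequence of tuples has the same type as another one if its finite initial segments satisfy
all the formulas that those of the other one satisfy: a formula mentions finitely many rows, and
one inclusion of complete types suffices. -/
theorem realize_iff_of_rowTuple {m : ℕ} {d d' : ℕ → Fin m → M}
    (h : ∀ (r : ℕ) (φ : L.Formula (Fin r × Fin m)),
      φ.Realize (rowTuple d Fin.val) → φ.Realize (rowTuple d' Fin.val))
    (χ : L.Formula (ℕ × Fin m)) :
    (χ.Realize fun p => d p.1 p.2) ↔ χ.Realize fun p => d' p.1 p.2 := by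
  classical
  let r := χ.freeVarFinset.sup (fun p => p.1) + 1
  let f : χ.freeVarFinset → Fin r × Fin m := fun p =>
    (⟨p.1.1, Nat.lt_succ_of_le (Finset.le_sup (f := fun p : ℕ × Fin m => p.1) p.2)⟩, p.1.2)
  have h1 : χ.Realize (fun p => d p.1 p.2) ↔
      Formula.Realize (χ.restrictFreeVar f) (rowTuple d Fin.val) :=
    (realize_restrictFreeVar_iff f fun p => rfl).symm
  have h2 : χ.Realize (fun p => d' p.1 p.2) ↔
      Formula.Realize (χ.restrictFreeVar f) (rowTuple d' Fin.val) :=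
    (realize_restrictFreeVar_iff f fun p => rfl).symm
  rw [h1, h2]
  refine ⟨h r _, fun h3 => by_contra fun h4 => ?_⟩
  exact Formula.realize_not.1
    (h r (Formula.not (χ.restrictFreeVar f)) (Formula.realize_not.2 h4)) h3

/-- If each formula of the type of `(b, e)` has consistent instances along the indiscernible
sequence `d`, then this type is realized by some `(b', d 0)` such that `d` is indiscernible
over `b'`. -/
theorem IsMonster.exists_indiscernibleOver [Nonempty M] {μ : Cardinal.{w}} (hM : IsMonster L M μ)
    (hμ : ℵ₀ < μ) {n m : ℕ} {b : Fin n → M} {e : Fin m → M} {d : ℕ → Fin m → M}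
    (hd : IsIndiscernibleOver L (∅ : Set M) d)
    (h : ∀ φ : L.Formula (Fin n ⊕ Fin m), φ.Realize (Sum.elim b e) →
      ∀ k : ℕ, ∃ x : Fin n → M, ∀ i < k, φ.Realize (Sum.elim x (d i))) :
    ∃ b' : Fin n → M, (∀ φ : L.Formula (Fin n ⊕ Fin m), φ.Realize (Sum.elim b e) →
      φ.Realize (Sum.elim b' (d 0))) ∧ IsIndiscernibleOver L (Set.range b') d := by
  classical
  -- by compactness, all the instances along `d` of the type of `(b, e)` are realized together
  have hconj (D : Finset (L.Formula (Fin n ⊕ Fin m)) × ℕ) : ∃ x : Fin n → M, ∀ φ ∈ D.1,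
      φ.Realize (Sum.elim b e) → ∀ i < D.2, φ.Realize (Sum.elim x (d i)) := by
    let ψ : L.Formula (Fin n ⊕ Fin m) :=
      Formula.iInf fun φ : (D.1.filter fun φ => φ.Realize (Sum.elim b e) :
        Finset (L.Formula (Fin n ⊕ Fin m))) => φ.1
    obtain ⟨x, hx⟩ := h ψ (Formula.realize_iInf.2 fun φ => (Finset.mem_filter.1 φ.2).2) D.2
    exact ⟨x, fun φ hφ hφ' i hi =>
      Formula.realize_iInf.1 (hx i hi) ⟨φ, Finset.mem_filter.2 ⟨hφ, hφ'⟩⟩⟩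
  choose x hx using hconj
  have hsmall : Cardinal.lift.{w} #(Fin n ⊕ ℕ × Fin m) < Cardinal.lift.{0} μ := by
    rw [Cardinal.lift_uzero]
    exact (Cardinal.lift_le_aleph0.2 Cardinal.mk_le_aleph0).trans_lt hμ
  obtain ⟨y, hy⟩ := hM.saturated.exists_realize rfl hsmall
    (map (fun D : Finset (L.Formula (Fin n ⊕ Fin m)) × ℕ =>
      (Sum.elim (x D) fun p => d p.1 p.2 : Fin n ⊕ ℕ × Fin m → M)) atTop)
  let y0 : Fin n → M := y ∘ Sum.inl
  let d0 : ℕ → Fin m → M := fun i k => y (Sum.inr (i, k))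
  have hy0 (φ : L.Formula (Fin n ⊕ Fin m)) (hφ : φ.Realize (Sum.elim b e)) (i : ℕ) :
      φ.Realize (Sum.elim y0 (d0 i)) := by
    have h1 := hy (φ.relabel (Sum.map id fun k => (i, k))) (by
      rw [eventually_map]
      filter_upwards [eventually_ge_atTop (({φ}, i + 1) :
        Finset (L.Formula (Fin n ⊕ Fin m)) × ℕ)] with D hD
      rw [Formula.realize_relabel]
      convert! hx D φ (hD.1 (Finset.mem_singleton_self _)) hφ i hD.2 using 1
      ext (k | k) <;> rfl)
    rw [Formula.realize_relabel] at h1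
    convert! h1 using 1
    ext (k | k) <;> rfl
  have hd0 {r : ℕ} (φ : L.Formula (Fin r × Fin m)) (i : Fin r → ℕ)
      (hφ : φ.Realize (rowTuple d i)) : φ.Realize (rowTuple d0 i) := by
    have h1 := hy (φ.relabel fun p => Sum.inr (i p.1, p.2)) (by
      rw [eventually_map]
      refine Eventually.of_forall fun D => ?_
      rw [Formula.realize_relabel]
      exact hφ)
    rwa [Formula.realize_relabel] at h1
  obtain ⟨b1, d1, hind, hEM⟩ := hM.saturated.exists_indiscernible hsmall y0 d0
  -- the sequence `d1` has the same type as `d`, and an automorphism takes it to `d`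
  have hsmall' : Cardinal.lift.{w} #(ℕ × Fin m) < Cardinal.lift.{0} μ := by
    rw [Cardinal.lift_uzero]
    exact (Cardinal.lift_le_aleph0.2 Cardinal.mk_le_aleph0).trans_lt hμ
  obtain ⟨σ, hσ⟩ := hM.stronglyHomogeneous.exists_equiv hsmall'
    (v := fun p => d1 p.1 p.2) (w := fun p => d p.1 p.2) fun χ =>
      (realize_iff_of_rowTuple (fun r φ hφ => by
        have h1 := hEM r (φ.relabel Sum.inr) (fun i hi => by
          rw [Formula.realize_relabel]
          exact hd0 φ i ((hd.realize_iff φ Fin.val_strictMono hi).1 hφ)) Fin.val Fin.val_strictMono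
        rwa [Formula.realize_relabel] at h1) χ).symm
  have hσ' (i : ℕ) : d i = σ ∘ d1 i := funext fun k => (hσ (i, k)).symm
  refine ⟨σ ∘ b1, fun φ hφ => ?_, isIndiscernibleOver_of_subset_range (b := σ ∘ b1)
    (fun r φ i j hi hj => ?_) subset_rfl⟩
  · rw [hσ' 0, realize_comp_equiv]
    have h1 := hEM 1 (φ.relabel (Sum.map id fun k => (0, k))) (fun i _ => by
      rw [Formula.realize_relabel]
      convert! hy0 φ hφ (i 0) using 1
      ext (k | k) <;> rfl) (fun _ => 0) (Subsingleton.strictMono _)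
    rw [Formula.realize_relabel] at h1
    convert! h1 using 1
    ext (k | k) <;> rfl
  · have h1 (t : Fin r → ℕ) : Sum.elim (σ ∘ b1) (rowTuple d t) =
        σ ∘ Sum.elim b1 (rowTuple d1 t) := by
      ext (k | p)
      · rfl
      · exact (hσ (t p.1, p.2)).symm
    rw [h1, h1, StrongHomClass.realize_formula, StrongHomClass.realize_formula]
    exact hind r φ i j hi hj

end Realization

/-! ### Colours on a regular cardinal -/

section Pigeonhole

/-- If each point of a regular cardinal `κ` lies below a point with one of fewer than `κ` colours,
then a single colour occurs cofinally. -/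
theorem exists_cofinal_colour {κ : Cardinal.{w}} (hκ : κ.IsRegular) {C : Type x}
    (hC : Cardinal.lift.{w} #C < Cardinal.lift.{x} κ) (Q : C → Set.Iio κ.ord → Prop)
    (h : ∀ γ, ∃ β, γ < β ∧ ∃ k, Q k β) : ∃ k, ∀ γ, ∃ β, γ < β ∧ Q k β := by
  by_contra! hcon
  choose g hg using hcon
  have hlt : ⨆ k, (g k : Ordinal.{w}) < κ.ord := by
    refine Ordinal.lift_iSup_lt_of_lt_cof ?_ fun k => (g k).2
    rwa [← Ordinal.lift_cof, hκ.cof_ord]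
  obtain ⟨β, hβ, k, hk⟩ := h ⟨_, hlt⟩
  refine hg k β (lt_of_le_of_lt ?_ hβ) hk
  exact le_ciSup (f := fun k => (g k : Ordinal.{w}))
    ⟨κ.ord, by rintro _ ⟨k, rfl⟩; exact (g k).2.le⟩ k

theorem mk_formula_le {L : FirstOrder.Language.{u, v}} (n m : ℕ) :
    #(L.Formula (Fin n ⊕ Fin m)) ≤ max L.card ℵ₀ := by
  have h1 : #(L.Formula (Fin n ⊕ Fin m)) ≤ #(Σ k, L.BoundedFormula (Fin n ⊕ Fin m) k) :=
    Cardinal.mk_le_of_injective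
      (sigma_mk_injective (β := fun k => L.BoundedFormula (Fin n ⊕ Fin m) k) (i := 0))
  refine h1.trans (BoundedFormula.card_le.trans (max_le (le_max_right _ _) ?_))
  refine Cardinal.add_le_of_le (le_max_right _ _) ?_ (by simp)
  refine le_trans ?_ (le_max_right _ _)
  exact Cardinal.lift_le_aleph0.2 Cardinal.mk_le_aleph0

end Pigeonhole

/-! ### Indiscernible SOP₁-arrays -/

section Equivalence

variable {L : FirstOrder.Language.{u, v}} {M : Type w} [L.Structure M] [Nonempty M]

theorem natIndex_strictMono {κ : Cardinal.{w}} (hκ : ℵ₀ ≤ κ) : StrictMono (natIndex hκ) :=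
  fun i j h => Subtype.mk_lt_mk.2 (Nat.cast_lt.2 h : (i : Ordinal.{w}) < j)

theorem mk_sum_Iio_ord_prod_lt {κ μ : Cardinal.{w}} (hκ : ℵ₀ ≤ κ) (hμ : κ < μ) (n m : ℕ) :
    Cardinal.lift.{w} #(Fin n ⊕ Set.Iio κ.ord × Fin 2 × Fin m) < Cardinal.lift.{w + 1} μ := by
  have h1 : #(Set.Iio κ.ord) = Cardinal.lift.{w + 1} κ := by
    rw [Cardinal.mk_Iio_ordinal, Cardinal.card_ord]
  have h2 : ℵ₀ ≤ Cardinal.lift.{w + 1} κ := Cardinal.aleph0_le_lift.2 hκ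
  have h3 : #(Fin n ⊕ Set.Iio κ.ord × Fin 2 × Fin m) ≤ Cardinal.lift.{w + 1} κ := by
    simp only [Cardinal.mk_sum, Cardinal.mk_prod, Cardinal.mk_fin, h1, Cardinal.lift_natCast,
      Cardinal.lift_mul, Cardinal.lift_lift]
    refine Cardinal.add_le_of_le h2 (Cardinal.natCast_lt_aleph0.le.trans h2) ?_
    refine Cardinal.mul_le_of_le h2 le_rfl ?_
    refine Cardinal.mul_le_of_le h2 ?_ ?_ <;> exact Cardinal.natCast_lt_aleph0.le.trans h2
  refine (Cardinal.lift_le.2 h3).trans_lt ?_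
  simpa using hμ

/-- The two tuples in a row of an indiscernible SOP₁-array are conjugate over the earlier rows. -/
theorem IsIndiscernibleSOP₁Array.exists_equiv {κ μ : Cardinal.{w}} (hκ : ℵ₀ ≤ κ) (hμ : κ < μ)
    (hM : IsMonster L M μ) {m : ℕ} {a : Set.Iio κ.ord → Fin 2 → Fin m → M}
    (ha : IsIndiscernibleSOP₁Array L a) (i : Set.Iio κ.ord) :
    ∃ σ : M ≃[L] M, (∀ j < i, ∀ e k, σ (a j e k) = a j e k) ∧ ∀ k, σ (a i 0 k) = a i 1 k := by
  have hA : #(∅ ∪ rowsBelow a i : Set M) < μ := by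
    let f : Fin 0 ⊕ Set.Iio κ.ord × Fin 2 × Fin m → M :=
      Sum.elim (fun x => x.elim0) fun p => a p.1 p.2.1 p.2.2
    have hsub : (∅ ∪ rowsBelow a i : Set M) ⊆ Set.range f := by
      rintro y (hy | ⟨j, -, e, k, rfl⟩)
      · exact absurd hy (Set.notMem_empty _)
      · exact ⟨Sum.inr (j, e, k), rfl⟩
    refine (Cardinal.mk_le_mk_of_subset hsub).trans_lt ?_
    rw [← Cardinal.lift_lt.{w, w + 1}]
    exact (Cardinal.mk_range_le_lift (f := f)).trans_lt (mk_sum_Iio_ord_prod_lt hκ hμ 0 m)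
  obtain ⟨σ, hσ, hσ'⟩ := hM.stronglyHomogeneous.exists_equiv_of_tpOver_eq (hκ.trans hμ.le) hA
    (ha.type_eq i)
  exact ⟨σ, fun j hj e k => hσ _ (Or.inr ⟨j, hj, e, k, rfl⟩), hσ'⟩

/-- In a monster model of an NSOP₁ theory, the type of `b` over the entry in the column `0` of
almost every row can be moved to the column `1`: otherwise cofinally many rows fail because of a
single formula, and these rows carry an SOP₁ pattern. -/
theorem IsNSOP₁.exists_forall_gt {T : L.Theory} (hT : IsNSOP₁ T) [M ⊨ T] {κ μ : Cardinal.{w}}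
    (hκ : κ.IsRegular)
    (hTκ : Cardinal.lift.{w} (max L.card ℵ₀) < Cardinal.lift.{max u v} κ)
    (hμ : κ < μ) (hM : IsMonster L M μ) {m n : ℕ} {a : Set.Iio κ.ord → Fin 2 → Fin m → M}
    (b : Fin n → M) (ha : IsIndiscernibleSOP₁Array L a) :
    ∃ γ : Set.Iio κ.ord, ∀ β : Set.Iio κ.ord, γ < β → ∃ b' : Fin n → M,
      T.typeOf (Sum.elim b (a β 0)) =
        T.typeOf (Sum.elim b' (a (natIndex hκ.aleph0_le 0) 1)) ∧
      IsIndiscernibleOver L (Set.range b') (fun i : ℕ => a (natIndex hκ.aleph0_le i) 1) := by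
  classical
  by_contra! hcon
  set d : ℕ → Fin m → M := fun i => a (natIndex hκ.aleph0_le i) 1 with hd
  have hrow (r : ℕ) (ψ : L.Formula (Fin r × Fin 2 × Fin m)) (i j : Fin r → Set.Iio κ.ord)
      (hi : StrictMono i) (hj : StrictMono j) :
      (ψ.Realize fun p => a (i p.1) p.2.1 p.2.2) ↔ ψ.Realize fun p => a (j p.1) p.2.1 p.2.2 :=
    ha.indiscernible.realize_iff ψ hi hj
  have hcol (r : ℕ) (ψ : L.Formula (Fin r × Fin m)) (i j : Fin r → Set.Iio κ.ord)
      (hi : StrictMono i) (hj : StrictMono j) :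
      (ψ.Realize fun p => a (i p.1) 1 p.2) ↔ ψ.Realize fun p => a (j p.1) 1 p.2 := by
    have h1 := hrow r (ψ.relabel fun p => (p.1, 1, p.2)) i j hi hj
    rwa [Formula.realize_relabel, Formula.realize_relabel] at h1
  have hdind : IsIndiscernibleOver L (∅ : Set M) d := by
    refine isIndiscernibleOver_of_subset_range (b := (Empty.elim : Empty → M))
      (fun r φ i j hi hj => ?_) (Set.empty_subset _)
    have h1 := hcol r (φ.relabel (Sum.elim Empty.elim id)) (natIndex hκ.aleph0_le ∘ i)
      (natIndex hκ.aleph0_le ∘ j) ((natIndex_strictMono _).comp hi)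
      ((natIndex_strictMono _).comp hj)
    rw [Formula.realize_relabel, Formula.realize_relabel] at h1
    convert! h1 using 2
    all_goals
      ext (k | k)
      · exact k.elim
      · rfl
  have hlt : Cardinal.lift.{w} #(L.Formula (Fin n ⊕ Fin m) × ℕ) < Cardinal.lift.{max u v} κ := by
    refine (Cardinal.lift_le.2 ?_).trans_lt hTκ
    rw [Cardinal.mk_prod]
    refine Cardinal.mul_le_of_le (le_max_right _ _) ?_ ?_
    · simpa using mk_formula_le n m
    · simp
  obtain ⟨⟨φ, k⟩, hφ⟩ := exists_cofinal_colour hκ hlt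
    (fun p β => p.1.Realize (Sum.elim b (a β 0)) ∧
      ¬ ∃ x : Fin n → M, ∀ i < p.2, p.1.Realize (Sum.elim x (d i))) fun γ => by
    obtain ⟨β, hβ, h1⟩ := hcon γ
    refine ⟨β, hβ, ?_⟩
    by_contra! h2
    obtain ⟨b', hb', hb''⟩ := hM.exists_indiscernibleOver (hκ.aleph0_le.trans_lt hμ) hdind
      (b := b) (e := a β 0) fun φ hφ k => h2 (φ, k) hφ
    refine h1 b' (typeOf_eq_typeOf_iff.2 fun φ => ⟨hb' φ, fun h3 => by_contra fun h4 => ?_⟩) hb''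
    exact Formula.realize_not.1 (hb' φ.not (Formula.realize_not.2 h4)) h3
  choose next hnext hφ hk using hφ
  let β : ℕ → Set.Iio κ.ord := fun i => next^[i + 1] (natIndex hκ.aleph0_le 0)
  have hβ (i : ℕ) : β i = next (next^[i] (natIndex hκ.aleph0_le 0)) :=
    Function.iterate_succ_apply' _ _ _
  have hβmono : StrictMono β := strictMono_nat_of_lt_succ fun i => by
    rw [hβ (i + 1)]
    exact hnext _
  obtain ⟨m', φ', hφ'⟩ := exists_hasSOP₁_of_array φ (fun i => a (β i))
    (fun i => by
      obtain ⟨σ, hσ, hσ'⟩ := ha.exists_equiv hκ.aleph0_le hμ hM (β i)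
      exact ⟨σ, fun j hj => hσ _ (hβmono hj), hσ'⟩)
    (fun r ψ i j hi hj => hrow r ψ _ _ (hβmono.comp hi) (hβmono.comp hj)) b
    (fun i => by rw [hβ]; exact hφ _) k (by
      rintro ⟨x, hx⟩
      have h1 := hcol k (jointlySatisfiable φ (ι := Fin k)) (β ∘ Fin.val)
        (natIndex hκ.aleph0_le ∘ Fin.val) (hβmono.comp Fin.val_strictMono)
        ((natIndex_strictMono _).comp Fin.val_strictMono)
      rw [realize_jointlySatisfiable, realize_jointlySatisfiable] at h1
      obtain ⟨x', hx'⟩ := h1.1 ⟨x, fun i => hx i i.2⟩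
      exact hk (natIndex hκ.aleph0_le 0) ⟨x', fun i hi => hx' ⟨i, hi⟩⟩)
  exact hT.not_hasSOP₁ φ' hφ'

/-- An SOP₁ tree in an elementarily equivalent structure yields, in a monster model, an
indiscernible SOP₁-array with all instances of `φ` in the column `0` realized by one tuple and
with pairwise inconsistent instances in the column `1`. -/
theorem IsMonster.exists_indiscernibleSOP₁Array {κ μ : Cardinal.{w}} (hκ : ℵ₀ ≤ κ) (hμ : κ < μ)
    (hM : IsMonster L M μ) {N : Type*} [L.Structure N] (hNM : N ≅[L] M) {n m : ℕ}
    {φ : L.Formula (Fin n ⊕ Fin m)} (hφ : HasSOP₁ N φ) :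
    ∃ (b : Fin n → M) (a : Set.Iio κ.ord → Fin 2 → Fin m → M), IsIndiscernibleSOP₁Array L a ∧
      (∀ i, φ.Realize (Sum.elim b (a i 0))) ∧ ∀ i j, i < j →
        ¬ ∃ x : Fin n → M, φ.Realize (Sum.elim x (a i 1)) ∧ φ.Realize (Sum.elim x (a j 1)) := by
  obtain ⟨b, c, hc0, hc1, hc⟩ := hM.saturated.exists_array_of_hasSOP₁ (hκ.trans_lt hμ) hNM hφ
  obtain ⟨b', c', hind, hEM⟩ := hM.saturated.exists_indiscernible (J := Set.Iio κ.ord)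
    (mk_sum_Iio_ord_prod_lt hκ hμ n m) b (fun i p => c i p.1 p.2)
  refine ⟨b', fun i e k => c' i (e, k),
    ⟨isIndiscernibleOver_of_subset_range hind (Set.empty_subset _), fun i =>
      tpOver_rowsBelow_eq fun r l hl hli θ => ?_⟩, fun i => ?_, fun i j hij => ?_⟩
  · -- the row `i` is put after the rows `l`
    have hlast : StrictMono (Fin.snoc (α := fun _ => Set.Iio κ.ord) l i) := by
      intro k k' hk
      induction k' using Fin.lastCases with
      | last =>
        obtain ⟨k, rfl⟩ := Fin.exists_castSucc_eq.2 hk.ne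
        simpa using hli k
      | cast k' =>
        obtain ⟨k, rfl⟩ := Fin.exists_castSucc_eq.2 (hk.trans (Fin.castSucc_lt_last k')).ne
        simpa using hl (Fin.castSucc_lt_castSucc_iff.1 hk)
    let f (e : Fin 2) : (Fin r × Fin 2 × Fin m) ⊕ Fin m →
        Fin n ⊕ Fin (r + 1) × Fin 2 × Fin m :=
      Sum.elim (fun p => Sum.inr (p.1.castSucc, p.2.1, p.2.2)) fun k => Sum.inr (Fin.last r, e, k)
    have h1 := hEM (r + 1) ((θ.relabel (f 0)).iff (θ.relabel (f 1))) (fun t ht => by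
      rw [Formula.realize_iff, Formula.realize_relabel, Formula.realize_relabel]
      have h2 := hc (t (Fin.last r)) (θ.relabel (Sum.map (fun p =>
        (⟨t p.1.castSucc, ht (Fin.castSucc_lt_last p.1)⟩, p.2.1, p.2.2)) id))
      rw [Formula.realize_relabel, Formula.realize_relabel] at h2
      convert! h2 using 2
      all_goals ext (k | k) <;> rfl) _ hlast
    rw [Formula.realize_iff, Formula.realize_relabel, Formula.realize_relabel] at h1
    convert! h1 using 2
    all_goals
      ext (k | k)
      · simp [f, rowTuple]
      · simp [f, rowTuple]
  · have h1 := hEM 1 (φ.relabel (Sum.map id fun k => (0, 0, k))) (fun t _ => by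
      rw [Formula.realize_relabel]
      convert! hc0 (t 0) using 1
      ext (k | k) <;> rfl) (fun _ => i) (Subsingleton.strictMono _)
    rw [Formula.realize_relabel] at h1
    convert! h1 using 1
    ext (k | k) <;> rfl
  · have hpair : StrictMono ![i, j] := Fin.strictMono_iff_lt_succ.2 fun k => by
      rw [Subsingleton.elim k 0]
      exact hij
    have h1 := hEM 2 ((jointlySatisfiable φ (ι := Fin 2)).relabel
      fun p => Sum.inr (p.1, 1, p.2)).not (fun t ht => by
        rw [Formula.realize_not, Formula.realize_relabel, realize_jointlySatisfiable]
        rintro ⟨x, hx⟩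
        exact hc1 (t 0) (t 1) (ht Fin.zero_lt_one) ⟨x, hx 0, hx 1⟩) ![i, j] hpair
    rw [Formula.realize_not, Formula.realize_relabel, realize_jointlySatisfiable] at h1
    rintro ⟨x, hx⟩
    refine h1 ⟨x, fun l => ?_⟩
    fin_cases l
    · exact hx.1
    · exact hx.2

end Equivalence
end ModelNSOP

theorem proposition3p12
    {L : FirstOrder.Language.{u, v}} (T : L.Theory) (hT : T.IsComplete)
    (κ : Cardinal.{w}) (hκ : κ.IsRegular)
    (hTκ : Cardinal.lift.{w} ((2 : Cardinal.{max u v}) ^ max L.card ℵ₀) <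
      Cardinal.lift.{max u v} κ)
    (M : Type w) [L.Structure M] [Nonempty M] [M ⊨ T]
    (μ : Cardinal.{w}) (hμ : κ < μ) (hM : IsMonster L M μ) :
    List.TFAE [
      IsNSOP₁ T,
      ∀ (m n : ℕ) (a : Set.Iio κ.ord → Fin 2 → Fin m → M) (b : Fin n → M),
        IsIndiscernibleSOP₁Array L a →
          ∃ (β : Set.Iio κ.ord) (b' : Fin n → M),
            T.typeOf (Sum.elim b (a β 0)) =
              T.typeOf (Sum.elim b' (a (natIndex hκ.aleph0_le 0) 1)) ∧
            IsIndiscernibleOver L (Set.range b')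
              (fun i : ℕ => a (natIndex hκ.aleph0_le i) 1),
      ∀ (m n : ℕ) (a : Set.Iio κ.ord → Fin 2 → Fin m → M) (b : Fin n → M),
        IsIndiscernibleSOP₁Array L a →
          ∃ γ : Set.Iio κ.ord, ∀ β : Set.Iio κ.ord, γ < β →
            ∃ b' : Fin n → M,
              T.typeOf (Sum.elim b (a β 0)) =
                T.typeOf (Sum.elim b' (a (natIndex hκ.aleph0_le 0) 1)) ∧
              IsIndiscernibleOver L (Set.range b')
                (fun i : ℕ => a (natIndex hκ.aleph0_le i) 1)] := by
  tfae_have 1 → 3 := fun h m n a b ha =>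
    h.exists_forall_gt hκ ((Cardinal.lift_le.2 (Cardinal.cantor _).le).trans_lt hTκ) hμ hM b ha
  tfae_have 3 → 2 := fun h m n a b ha => by
    obtain ⟨γ, hγ⟩ := h m n a b ha
    have hlim : Order.succ (γ : Ordinal.{w}) < κ.ord :=
      (Cardinal.isSuccLimit_ord hκ.aleph0_le).succ_lt γ.2
    exact ⟨⟨_, hlim⟩, hγ ⟨_, hlim⟩ (Subtype.mk_lt_mk.2 (Order.lt_succ _))⟩
  tfae_have 2 → 1 := fun h N n m φ hφ => by
    have hNM : N ≅[L] M := FirstOrder.Language.elementarilyEquivalent_iff.2 fun ψ =>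
      (hT.realize_sentence_iff ψ N).trans (hT.realize_sentence_iff ψ M).symm
    obtain ⟨b, a, ha, ha0, ha1⟩ := hM.exists_indiscernibleSOP₁Array hκ.aleph0_le hμ hNM hφ
    obtain ⟨β, b', htp, hind⟩ := h m n a b ha
    have h0 : φ.Realize (Sum.elim b' (a (natIndex hκ.aleph0_le 0) 1)) :=
      (typeOf_eq_typeOf_iff.1 htp φ).1 (ha0 β)
    -- indiscernibility over `b'` moves the instance from the row `0` to the row `1`
    have h1 := tpOver_eq_iff.1 (hind 1 (fun _ => 0) (fun _ => 1) (Subsingleton.strictMono _)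
      (Subsingleton.strictMono _))
      (φ.relabel (Sum.map (fun k => ⟨b' k, k, rfl⟩) fun k => (0, k)))
    rw [FirstOrder.Language.Formula.realize_relabel,
      FirstOrder.Language.Formula.realize_relabel, Sum.elim_comp_map, Sum.elim_comp_map] at h1
    exact ha1 _ _ (natIndex_strictMono hκ.aleph0_le Nat.zero_lt_one) ⟨b', h0, h1.1 h0⟩
  tfae_finish
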